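/- \textbf{Conventions.} Let $n,m\ge 1$ be integers, $1<p<\infty$, and let $\Omega\subset\mathbb{R}^n$ be open. $W^{m,p}(\Omega)$ denotes the space of real functions $u\in L^p(\Omega)$ whose weak derivatives $D^\alpha u$, $|\alpha|\le m$, exist and belong to $L^p(\Omega)$, with norm $\big(\sum_{|\alpha|\le m}\int_\Omega|D^\alpha u|^p\,dx\big)^{1/p}$. $\Omega$ is a \emph{$W^{m,p}$-extension domain} if there is a bounded linear operator $\mathcal{E}:W^{m,p}(\Omega)\to W^{m,p}(\mathbb{R}^n)$ with $\mathcal{E}u|_\Omega=u$ for every $u\in W^{m,p}(\Omega)$. For $f\in W^{m,p}(\Omega)$ the Taylor remainder of order $m-1$ is \[ R^{m-1}f(x,y)=f(x)-\sum_{|\alpha|\le m-1}D^\alpha f(y)\,\frac{(x-y)^\alpha}{\alpha!}. \] Let $(\rho_\varepsilon)_{\varepsilon>0}$ be a family of nonnegative functions $\rho_\varepsilon\in L^1_{\rm loc}(0,\infty)$ such that \[ \int_0^\infty\rho_\varepsilon(r)\,r^{n-1}\,dr=1\quad(\varepsilon>0),\qquad \lim_{\varepsilon\to0}\int_\delta^\infty\rho_\varepsilon(r)\,r^{n-1}\,dr=0\quad\text{for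 every }\delta>0 . \] \textbf{Theorem.} Assume that $\Omega$ is a $W^{m,p}$-extension domain and let $f\in W^{m,p}(\Omega)$. Then \[ \lim_{\varepsilon\to0^+}\int_\Omega\int_\Omega\frac{|R^{m-1}f(x,y)|^p}{|x-y|^{mp}}\,\rho_\varepsilon(|x-y|)\,dx\,dy =\int_\Omega\int_{\partial B(0,1)}\Big|\sum_{|\alpha|=m}\frac{D^\alpha f(x)}{\alpha!}\,e^\alpha\Big|^p\,de\,dx , \] where $de$ is the surface measure of the unit sphere $\partial B(0,1)\subset\mathbb{R}^n$; in particular the limit exists, and the right-hand side is finite. -/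

import Mathlib

open MeasureTheory Set Filter Topology
open scoped ContDiff ENNReal

noncomputable section

namespace HigherSobolev

variable {n : ℕ}

/-- The order `|α| = α₁ + ⋯ + αₙ` of a multi-index. -/
def order (α : Fin n → ℕ) : ℕ := ∑ i, α i

/-- The finite set of the multi-indices `α` of length `n` with `|α| = k`. -/
def multiIndices (n k : ℕ) : Finset (Fin n → ℕ) := Finset.piAntidiag Finset.univ k

theorem mem_multiIndices {k : ℕ} {α : Fin n → ℕ} : α ∈ multiIndices n k ↔ order α = k := by
  simp [multiIndices, order]

/-- The monomial `x^α = x₁^{α₁} ⋯ xₙ^{αₙ}`. -/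
def monomial (α : Fin n → ℕ) (x : EuclideanSpace ℝ (Fin n)) : ℝ := ∏ i, x i ^ α i

/-- The factorial `α! = α₁! ⋯ αₙ!`. -/
def multiFactorial (α : Fin n → ℕ) : ℝ := ∏ i, ((α i).factorial : ℝ)

/-- The classical partial derivative `∂φ/∂xᵢ`. -/
def partialDeriv (i : Fin n) (φ : EuclideanSpace ℝ (Fin n) → ℝ) :
    EuclideanSpace ℝ (Fin n) → ℝ :=
  fun x => fderiv ℝ φ x (EuclideanSpace.single i 1)

/-- The classical iterated partial derivative `∂₁^{α₁} ⋯ ∂ₙ^{αₙ} φ` (used for smooth `φ`). -/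
def classicalDeriv (α : Fin n → ℕ) (φ : EuclideanSpace ℝ (Fin n) → ℝ) :
    EuclideanSpace ℝ (Fin n) → ℝ :=
  (List.finRange n).foldr (fun i ψ => (partialDeriv i)^[α i] ψ) φ

/-- `φ ∈ C₀^∞(Ω)`: a smooth function on `ℝⁿ` with compact support contained in `Ω`. -/
structure IsTestFunction (Ω : Set (EuclideanSpace ℝ (Fin n)))
    (φ : EuclideanSpace ℝ (Fin n) → ℝ) : Prop where
  smooth : ContDiff ℝ ∞ φ
  compact : HasCompactSupport φ
  support : tsupport φ ⊆ Ω

theorem IsTestFunction.partialDeriv {Ω : Set (EuclideanSpace ℝ (Fin n))}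
    {φ : EuclideanSpace ℝ (Fin n) → ℝ} (h : IsTestFunction Ω φ) (i : Fin n) :
    IsTestFunction Ω (partialDeriv i φ) := by
  have hs : tsupport (HigherSobolev.partialDeriv i φ) ⊆ tsupport φ := by
    refine closure_minimal (fun x hx => ?_) (isClosed_tsupport φ)
    refine support_fderiv_subset ℝ (f := φ) ?_
    intro h0
    exact hx (by simp [HigherSobolev.partialDeriv, h0])
  refine ⟨?_, ?_, hs.trans h.support⟩
  · exact (h.smooth.fderiv_right (m := ∞) (by simp)).clm_apply contDiff_const
  · exact h.compact.of_isClosed_subset (isClosed_tsupport _) hs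

theorem IsTestFunction.classicalDeriv {Ω : Set (EuclideanSpace ℝ (Fin n))}
    {φ : EuclideanSpace ℝ (Fin n) → ℝ} (h : IsTestFunction Ω φ) (α : Fin n → ℕ) :
    IsTestFunction Ω (classicalDeriv α φ) := by
  unfold HigherSobolev.classicalDeriv
  induction List.finRange n with
  | nil => exact h
  | cons i l ih =>
    rw [List.foldr_cons]
    induction α i with
    | zero => exact ih
    | succ k ihk =>
      rw [Function.iterate_succ_apply']
      exact ihk.partialDeriv i

/-- A locally integrable function on `Ω` times a test function is integrable on `Ω`. -/
theorem IsTestFunction.integrableOn_mul {Ω : Set (EuclideanSpace ℝ (Fin n))}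
    {f φ : EuclideanSpace ℝ (Fin n) → ℝ} (h : IsTestFunction Ω φ)
    (hf : LocallyIntegrableOn f Ω) : IntegrableOn (fun x => f x * φ x) Ω := by
  have h1 : IntegrableOn (fun x => f x * φ x) (tsupport φ) :=
    (hf.integrableOn_compact_subset h.support h.compact).mul_continuousOn
      h.smooth.continuous.continuousOn h.compact
  have h2 : Integrable (fun x => f x * φ x) := by
    rw [← integrableOn_iff_integrable_of_support_subset (s := tsupport φ)]
    · exact h1
    · intro x hx
      exact subset_tsupport φ (fun h0 => hx (by simp [h0]))
  exact h2.integrableOn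

/-- `g` is a weak derivative `D^α f` on the open set `Ω`. -/
structure HasWeakDeriv (Ω : Set (EuclideanSpace ℝ (Fin n))) (α : Fin n → ℕ)
    (f g : EuclideanSpace ℝ (Fin n) → ℝ) : Prop where
  locallyIntegrable_left : LocallyIntegrableOn f Ω
  locallyIntegrable_right : LocallyIntegrableOn g Ω
  integral_eq : ∀ φ, IsTestFunction Ω φ →
    ∫ x in Ω, f x * classicalDeriv α φ x = (-1) ^ order α * ∫ x in Ω, g x * φ x

theorem HasWeakDeriv.congr {Ω : Set (EuclideanSpace ℝ (Fin n))} {α : Fin n → ℕ}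
    {f f' g : EuclideanSpace ℝ (Fin n) → ℝ} (hΩ : IsOpen Ω) (h : HasWeakDeriv Ω α f g)
    (hf : f =ᵐ[volume.restrict Ω] f') : HasWeakDeriv Ω α f' g := by
  refine ⟨?_, h.2, fun φ hφ => ?_⟩
  · have h1 := (locallyIntegrableOn_iff hΩ.isLocallyClosed).1 h.1
    rw [locallyIntegrableOn_iff hΩ.isLocallyClosed]
    intro K hK hc
    exact (h1 K hK hc).congr (ae_restrict_of_ae_restrict_of_subset hK hf)
  · rw [← h.3 φ hφ]
    exact integral_congr_ae (hf.mono fun x hx => by simp only [hx])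

theorem HasWeakDeriv.add {Ω : Set (EuclideanSpace ℝ (Fin n))} {α : Fin n → ℕ}
    {f f' g g' : EuclideanSpace ℝ (Fin n) → ℝ} (h : HasWeakDeriv Ω α f g)
    (h' : HasWeakDeriv Ω α f' g') : HasWeakDeriv Ω α (f + f') (g + g') := by
  refine ⟨h.1.add h'.1, h.2.add h'.2, fun φ hφ => ?_⟩
  simp only [Pi.add_apply, add_mul]
  rw [integral_add ((hφ.classicalDeriv α).integrableOn_mul h.1)
      ((hφ.classicalDeriv α).integrableOn_mul h'.1),
    integral_add (hφ.integrableOn_mul h.2) (hφ.integrableOn_mul h'.2), h.3 φ hφ, h'.3 φ hφ]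
  ring

theorem HasWeakDeriv.smul {Ω : Set (EuclideanSpace ℝ (Fin n))} {α : Fin n → ℕ}
    {f g : EuclideanSpace ℝ (Fin n) → ℝ} (c : ℝ) (h : HasWeakDeriv Ω α f g) :
    HasWeakDeriv Ω α (c • f) (c • g) := by
  refine ⟨h.1.smul c, h.2.smul c, fun φ hφ => ?_⟩
  simp only [Pi.smul_apply, smul_eq_mul, mul_assoc]
  rw [integral_const_mul, integral_const_mul, h.3 φ hφ]
  ring

theorem HasWeakDeriv.zero (Ω : Set (EuclideanSpace ℝ (Fin n))) (α : Fin n → ℕ) :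
    HasWeakDeriv Ω α 0 0 :=
  ⟨locallyIntegrable_zero.locallyIntegrableOn Ω, locallyIntegrable_zero.locallyIntegrableOn Ω,
    fun φ _ => by simp⟩

open Classical in
/-- The weak derivative `D^α f` on `Ω`. It is determined almost everywhere on `Ω`
(for `α = 0` it is `f`), and a representative is chosen; it is `0` if `f` has no weak derivative. -/
def weakDeriv (Ω : Set (EuclideanSpace ℝ (Fin n))) (α : Fin n → ℕ)
    (f : EuclideanSpace ℝ (Fin n) → ℝ) : EuclideanSpace ℝ (Fin n) → ℝ :=
  if h : ∃ g, HasWeakDeriv Ω α f g then h.choose else 0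

/-- `f ∈ W^{m,p}(Ω)`: `f ∈ L^p(Ω)` and, for `|α| ≤ m`, the weak derivative `D^α f` exists and
belongs to `L^p(Ω)`. -/
def MemSobolev (Ω : Set (EuclideanSpace ℝ (Fin n))) (m : ℕ) (p : ℝ)
    (f : EuclideanSpace ℝ (Fin n) → ℝ) : Prop :=
  MemLp f (ENNReal.ofReal p) (volume.restrict Ω) ∧
    ∀ α : Fin n → ℕ, order α ≤ m →
      ∃ g, HasWeakDeriv Ω α f g ∧ MemLp g (ENNReal.ofReal p) (volume.restrict Ω)

theorem MemSobolev.congr {Ω : Set (EuclideanSpace ℝ (Fin n))} {m : ℕ} {p : ℝ}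
    {f f' : EuclideanSpace ℝ (Fin n) → ℝ} (hΩ : IsOpen Ω) (h : MemSobolev Ω m p f)
    (hf : f =ᵐ[volume.restrict Ω] f') : MemSobolev Ω m p f' := by
  refine ⟨h.1.ae_eq hf, fun α hα => ?_⟩
  obtain ⟨g, hg, hg'⟩ := h.2 α hα
  exact ⟨g, hg.congr hΩ hf, hg'⟩

/-- The vector space `W^{m,p}(Ω)`, of classes of functions modulo equality almost everywhere. -/
def sobolevSpace (Ω : TopologicalSpace.Opens (EuclideanSpace ℝ (Fin n))) (m : ℕ) (p : ℝ) :
    Submodule ℝ (Lp ℝ (ENNReal.ofReal p)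
      (volume.restrict (Ω : Set (EuclideanSpace ℝ (Fin n))))) where
  carrier := {u | MemSobolev (Ω : Set (EuclideanSpace ℝ (Fin n))) m p u}
  zero_mem' := by
    refine MemSobolev.congr (f := 0) Ω.isOpen ⟨MemLp.zero, fun α _ => ?_⟩ (Lp.coeFn_zero _ _ _).symm
    exact ⟨0, HasWeakDeriv.zero _ α, MemLp.zero⟩
  add_mem' := by
    intro u v hu hv
    refine MemSobolev.congr
      (f := (u : EuclideanSpace ℝ (Fin n) → ℝ) + (v : EuclideanSpace ℝ (Fin n) → ℝ)) Ω.isOpen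
      ⟨hu.1.add hv.1, fun α hα => ?_⟩ (Lp.coeFn_add u v).symm
    obtain ⟨g, hg, hg'⟩ := hu.2 α hα
    obtain ⟨k, hk, hk'⟩ := hv.2 α hα
    exact ⟨g + k, hg.add hk, hg'.add hk'⟩
  smul_mem' := by
    intro c u hu
    refine MemSobolev.congr (f := c • (u : EuclideanSpace ℝ (Fin n) → ℝ)) Ω.isOpen
      ⟨hu.1.const_smul c, fun α hα => ?_⟩ (Lp.coeFn_smul c u).symm
    obtain ⟨g, hg, hg'⟩ := hu.2 α hα
    exact ⟨c • g, hg.smul c, hg'.const_smul c⟩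

/-- The norm `(∑_{|α| ≤ m} ∫_Ω |D^α u|^p dx)^{1/p}` of `W^{m,p}(Ω)`. -/
def sobolevNorm (Ω : Set (EuclideanSpace ℝ (Fin n))) (m : ℕ) (p : ℝ)
    (u : EuclideanSpace ℝ (Fin n) → ℝ) : ℝ :=
  (∑ k ∈ Finset.range (m + 1), ∑ α ∈ multiIndices n k,
    ∫ x in Ω, |weakDeriv Ω α u x| ^ p) ^ (1 / p)

/-- `Ω` is a `W^{m,p}`-extension domain: there is a bounded linear operator
`T : W^{m,p}(Ω) → W^{m,p}(ℝⁿ)` with `T u = u` on `Ω` for all `u`. -/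
def IsExtensionDomain (Ω : TopologicalSpace.Opens (EuclideanSpace ℝ (Fin n))) (m : ℕ) (p : ℝ) :
    Prop :=
  ∃ T : sobolevSpace Ω m p →ₗ[ℝ] sobolevSpace (⊤ : TopologicalSpace.Opens _) m p,
    (∃ C : ℝ, ∀ u, sobolevNorm univ m p (T u).1 ≤ C * sobolevNorm Ω m p u.1) ∧
    ∀ u, ((T u).1 : EuclideanSpace ℝ (Fin n) → ℝ)
      =ᵐ[volume.restrict (Ω : Set (EuclideanSpace ℝ (Fin n)))] u.1

/-- The (formal) Taylor polynomial `T_y^k f(x) = ∑_{|α| ≤ k} D^α f(y) (x - y)^α / α!`. -/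
def taylorPoly (Ω : Set (EuclideanSpace ℝ (Fin n))) (k : ℕ) (f : EuclideanSpace ℝ (Fin n) → ℝ)
    (y x : EuclideanSpace ℝ (Fin n)) : ℝ :=
  ∑ j ∈ Finset.range (k + 1), ∑ α ∈ multiIndices n j,
    weakDeriv Ω α f y * (monomial α (x - y) / multiFactorial α)

/-- The Taylor remainder `R^k f(x, y) = f(x) - T_y^k f(x)`. -/
def taylorRemainder (Ω : Set (EuclideanSpace ℝ (Fin n))) (k : ℕ)
    (f : EuclideanSpace ℝ (Fin n) → ℝ) (x y : EuclideanSpace ℝ (Fin n)) : ℝ :=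
  f x - taylorPoly Ω k f y x

/-- A family `(ρ_ε)_{ε > 0}` of radial mollifiers in dimension `n`. -/
structure IsMollifierFamily (n : ℕ) (ρ : ℝ → ℝ → ℝ) : Prop where
  locallyIntegrable : ∀ ε, 0 < ε → LocallyIntegrableOn (ρ ε) (Ioi 0)
  nonneg : ∀ ε, 0 < ε → ∀ r, 0 < r → 0 ≤ ρ ε r
  integral_eq_one : ∀ ε, 0 < ε → ∫ r in Ioi (0 : ℝ), ρ ε r * r ^ (n - 1) = 1
  tendsto_tail : ∀ δ : ℝ, 0 < δ →
    Tendsto (fun ε => ∫ r in Ioi δ, ρ ε r * r ^ (n - 1)) (𝓝[>] 0) (𝓝 0)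

/-- `∫_Ω ∫_Ω |R^{m-1} f(x,y)|^p |x-y|^{-mp} η(|x-y|) dx dy ∈ [0, ∞]`. -/
def remainderEnergy (Ω : Set (EuclideanSpace ℝ (Fin n))) (m : ℕ) (p : ℝ) (η : ℝ → ℝ)
    (f : EuclideanSpace ℝ (Fin n) → ℝ) : ℝ≥0∞ :=
  ∫⁻ y in Ω, ∫⁻ x in Ω,
    ENNReal.ofReal (|taylorRemainder Ω (m - 1) f x y| ^ p / ‖x - y‖ ^ (m * p) * η ‖x - y‖)

/-- `∫_Ω ∫_{∂B(0,1)} |∑_{|α| = m} D^α f(x) e^α / α!|^p de dx ∈ [0, ∞]`, where `de` is the surface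
measure of the unit sphere. -/
def sphericalEnergy (Ω : Set (EuclideanSpace ℝ (Fin n))) (m : ℕ) (p : ℝ)
    (f : EuclideanSpace ℝ (Fin n) → ℝ) : ℝ≥0∞ :=
  ∫⁻ x in Ω, ∫⁻ e : Metric.sphere (0 : EuclideanSpace ℝ (Fin n)) 1,
    ENNReal.ofReal (|∑ α ∈ multiIndices n m,
      weakDeriv Ω α f x / multiFactorial α * monomial α (e : EuclideanSpace ℝ (Fin n))| ^ p)
    ∂((volume : Measure (EuclideanSpace ℝ (Fin n))).toSphere)

end HigherSobolev

end

open MeasureTheory Set Filter Topology HigherSobolev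

/-!
The theorem describes the limit, as the kernels concentrate, of an `L^p` norm in the pair `(y, h)`
with `h = x - y`. Let `F` be an extension of `f` to `ℝⁿ` with weak derivatives `D α`. The integrand
is the `p`-th power of the normalized remainder `R(y, h) / |h|^m` over the pairs with `y + h ∈ Ω`,
and `R(y, h)` is compared with the leading term `P(y, h) = ∑_{|α| = m} D α (y) h^α / α!`
(`taylorTerm D m y h`). All norms are taken with respect to `dy ⊗ ρ_ε(|h|) dh` on `Ω × ℝⁿ`.

* `P(y, h) / |h|^m` is homogeneous of degree `0` in `h`. In polar coordinates its norm factors, and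
  since `ρ_ε` is normalized, the `p`-th power of the norm is the spherical energy for every `ε`
  (`lintegral_radialMeasure_of_homogeneous`).
* Taylor's formula with integral remainder holds for `F` at almost every base point
  (`ae_taylor_formula`): tested against `φ ∈ C₀^∞`, it becomes, after moving derivatives and
  translations onto `φ`, the classical formula for `φ` with increment `-h` (`taylor_formula`). So
  `R - P` is an average over `t ∈ [0, 1]` of `∑_{|α| = m} (D α (y + t h) - D α (y)) h^α / α!`, and
  by Jensen's inequality its norm, for fixed `h`, is at most `|h|^m` times an averaged `L^p` modulus
  of continuity of the `D α` (`lintegral_remainder_sub_leading_le`). This modulus is bounded and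
  tends to `0` with `h`, while the kernels concentrate at `h = 0`, so `(R - P) / |h|^m` tends to `0`
  in norm (`tendsto_remainder_sub_leading`).
* The pairs with `y + h ∉ Ω` contribute nothing to the norm of `P / |h|^m` in the limit: for fixed
  `y ∈ Ω` such `h` stay away from the origin, and dominated convergence applies
  (`tendsto_leading_exterior`).

The triangle inequality combines the three facts in `tendsto_energy`. Weak derivatives are unique
almost everywhere, so those of `F` represent those of `f` on `Ω`
(`IsExtensionDomain.exists_extension`).
-/

namespace HigherSobolev

variable {n : ℕ}

/-! ### Classical Taylor expansion in multi-index form -/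

theorem contDiff_partialDeriv {φ : EuclideanSpace ℝ (Fin n) → ℝ} (h : ContDiff ℝ ∞ φ)
    (i : Fin n) : ContDiff ℝ ∞ (partialDeriv i φ) :=
  (h.fderiv_right (m := ∞) (by simp)).clm_apply contDiff_const

theorem contDiff_iterate_partialDeriv {φ : EuclideanSpace ℝ (Fin n) → ℝ} (h : ContDiff ℝ ∞ φ)
    (i : Fin n) (k : ℕ) : ContDiff ℝ ∞ ((partialDeriv i)^[k] φ) := by
  induction k with
  | zero => exact h
  | succ k ih =>
    rw [Function.iterate_succ_apply']
    exact contDiff_partialDeriv ih i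

theorem contDiff_foldr_partialDeriv {φ : EuclideanSpace ℝ (Fin n) → ℝ} (h : ContDiff ℝ ∞ φ)
    (α : Fin n → ℕ) (l : List (Fin n)) :
    ContDiff ℝ ∞ (l.foldr (fun i ψ => (partialDeriv i)^[α i] ψ) φ) := by
  induction l with
  | nil => exact h
  | cons i l ih => exact contDiff_iterate_partialDeriv ih i _

theorem contDiff_classicalDeriv {φ : EuclideanSpace ℝ (Fin n) → ℝ} (h : ContDiff ℝ ∞ φ)
    (α : Fin n → ℕ) : ContDiff ℝ ∞ (classicalDeriv α φ) :=
  contDiff_foldr_partialDeriv h α _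

theorem partialDeriv_comm {φ : EuclideanSpace ℝ (Fin n) → ℝ} (h : ContDiff ℝ ∞ φ)
    (i j : Fin n) : partialDeriv i (partialDeriv j φ) = partialDeriv j (partialDeriv i φ) := by
  funext x
  have hd : DifferentiableAt ℝ (fderiv ℝ φ) x :=
    ((h.fderiv_right (m := ∞) (by simp)).differentiable (by simp)).differentiableAt
  have key : ∀ a b : Fin n, partialDeriv a (partialDeriv b φ) x
      = fderiv ℝ (fderiv ℝ φ) x (EuclideanSpace.single a 1) (EuclideanSpace.single b 1) := by
    intro a b
    unfold partialDeriv
    rw [fderiv_clm_apply hd (differentiableAt_const _)]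
    simp
  rw [key, key]
  have hs : IsSymmSndFDerivAt ℝ φ x := h.contDiffAt.isSymmSndFDerivAt
    (by rw [minSmoothness_of_isRCLikeNormedField]; exact WithTop.coe_le_coe.2 le_top)
  exact hs.eq _ _

theorem iterate_partialDeriv_comm {φ : EuclideanSpace ℝ (Fin n) → ℝ} (h : ContDiff ℝ ∞ φ)
    (i j : Fin n) (k : ℕ) :
    (partialDeriv j)^[k] (partialDeriv i φ) = partialDeriv i ((partialDeriv j)^[k] φ) := by
  induction k with
  | zero => rfl
  | succ k ih =>
    rw [Function.iterate_succ_apply', Function.iterate_succ_apply', ih,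
      partialDeriv_comm (contDiff_iterate_partialDeriv h j k)]

theorem foldr_partialDeriv_add_single {φ : EuclideanSpace ℝ (Fin n) → ℝ} (h : ContDiff ℝ ∞ φ)
    (α : Fin n → ℕ) (i : Fin n) (l : List (Fin n)) (hl : l.Nodup) :
    l.foldr (fun j ψ => (partialDeriv j)^[(α + Pi.single i 1 : Fin n → ℕ) j] ψ) φ =
      if i ∈ l then partialDeriv i (l.foldr (fun j ψ => (partialDeriv j)^[α j] ψ) φ)
      else l.foldr (fun j ψ => (partialDeriv j)^[α j] ψ) φ := by
  induction l with
  | nil => simp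
  | cons j l ih =>
    rw [List.nodup_cons] at hl
    rw [List.foldr_cons, List.foldr_cons, ih hl.2]
    by_cases hij : j = i
    · subst hij
      simp only [hl.1, if_false, List.mem_cons, true_or, if_true, Pi.add_apply, Pi.single_eq_same]
      rw [Function.iterate_succ_apply']
    · have hij' : i ≠ j := fun h => hij h.symm
      simp only [Pi.add_apply, Pi.single_eq_of_ne hij, add_zero, List.mem_cons, hij', false_or]
      split_ifs
      · exact iterate_partialDeriv_comm (contDiff_foldr_partialDeriv h α l) i j _
      · rfl

theorem classicalDeriv_add_single {φ : EuclideanSpace ℝ (Fin n) → ℝ} (h : ContDiff ℝ ∞ φ)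
    (α : Fin n → ℕ) (i : Fin n) :
    classicalDeriv (α + Pi.single i 1) φ = partialDeriv i (classicalDeriv α φ) := by
  unfold classicalDeriv
  rw [foldr_partialDeriv_add_single h α i _ (List.nodup_finRange n),
    if_pos (List.mem_finRange i)]

theorem classicalDeriv_zero (φ : EuclideanSpace ℝ (Fin n) → ℝ) : classicalDeriv 0 φ = φ := by
  unfold classicalDeriv
  induction List.finRange n with
  | nil => rfl
  | cons i l ih => rw [List.foldr_cons, ih]; rfl

/-- The homogeneous part `∑_{|α| = j} D_α(y) h^α / α!` of degree `j` of the formal Taylor expansion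
at `y` of a function with derivatives `D`, evaluated at the increment `h`. -/
noncomputable def taylorTerm (D : (Fin n → ℕ) → EuclideanSpace ℝ (Fin n) → ℝ) (j : ℕ)
    (y h : EuclideanSpace ℝ (Fin n)) : ℝ :=
  ∑ α ∈ multiIndices n j, D α y * (monomial α h / multiFactorial α)

theorem multiFactorial_pos (α : Fin n → ℕ) : 0 < multiFactorial α :=
  Finset.prod_pos fun i _ => by exact_mod_cast (α i).factorial_pos

theorem monomial_add_single (α : Fin n → ℕ) (i : Fin n) (h : EuclideanSpace ℝ (Fin n)) :
    monomial (α + Pi.single i 1) h = h i * monomial α h := by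
  unfold monomial
  rw [Finset.prod_congr rfl (g := fun j => h j ^ α j * (if j = i then h i else 1)),
    Finset.prod_mul_distrib, Finset.prod_ite_eq' Finset.univ i]
  · simp [mul_comm]
  · intro j _
    by_cases hj : j = i
    · subst hj; simp [pow_succ]
    · simp [hj]

theorem multiFactorial_add_single (α : Fin n → ℕ) (i : Fin n) :
    multiFactorial (α + Pi.single i 1) = (α i + 1) * multiFactorial α := by
  unfold multiFactorial
  rw [Finset.prod_congr rfl
    (g := fun j => ((α j).factorial : ℝ) * (if j = i then (α i + 1 : ℝ) else 1)),
    Finset.prod_mul_distrib, Finset.prod_ite_eq' Finset.univ i]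
  · simp [mul_comm]
  · intro j _
    by_cases hj : j = i
    · subst hj; simp [Nat.factorial_succ, mul_comm]
    · simp [hj]

theorem order_add_single (α : Fin n → ℕ) (i : Fin n) :
    order (α + Pi.single i 1) = order α + 1 := by
  simp [order, Finset.sum_add_distrib]

/-- Summing over the ways to raise one exponent of a multi-index of order `j` counts each
multi-index of order `j + 1`, weighted by its Taylor coefficient, exactly `j + 1` times. -/
theorem sum_multiIndices_succ (j : ℕ) (c : (Fin n → ℕ) → ℝ) (h : EuclideanSpace ℝ (Fin n)) :
    ∑ α ∈ multiIndices n j,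
        (∑ i, h i * c (α + Pi.single i 1)) * (monomial α h / multiFactorial α)
      = (j + 1) * ∑ β ∈ multiIndices n (j + 1), c β * (monomial β h / multiFactorial β) := by
  have h1 : ((j : ℝ) + 1) * ∑ β ∈ multiIndices n (j + 1),
      c β * (monomial β h / multiFactorial β)
      = ∑ i, ∑ β ∈ multiIndices n (j + 1),
        (β i : ℝ) * (c β * (monomial β h / multiFactorial β)) := by
    rw [Finset.sum_comm, Finset.mul_sum]
    refine Finset.sum_congr rfl fun β hβ => ?_
    rw [← Finset.sum_mul]
    congr 1
    rw [mem_multiIndices] at hβ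
    have : ((order β : ℕ) : ℝ) = (j : ℝ) + 1 := by rw [hβ]; push_cast; ring
    rw [← this, order]; push_cast; rfl
  rw [h1]
  simp_rw [Finset.sum_mul]
  rw [Finset.sum_comm]
  refine Finset.sum_congr rfl fun i _ => ?_
  refine Finset.sum_of_injOn (fun α => α + Pi.single i 1) ?_ ?_ ?_ ?_
  · intro a _ b _ hab
    exact add_right_cancel hab
  · intro a ha
    simp only [Finset.mem_coe, mem_multiIndices] at ha ⊢
    rw [order_add_single, ha]
  · intro β hβ hβ'
    by_cases h0 : β i = 0
    · simp [h0]
    · exfalso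
      apply hβ'
      have hβe : β - Pi.single i 1 + Pi.single i 1 = β := by
        funext k
        by_cases hk : k = i
        · subst hk; simp; omega
        · simp [hk]
      refine ⟨β - Pi.single i 1, ?_, hβe⟩
      rw [mem_multiIndices] at hβ
      have := order_add_single (β - Pi.single i 1) i
      rw [hβe, hβ] at this
      simp only [Finset.mem_coe, mem_multiIndices]
      omega
  · intro α _
    simp only [monomial_add_single, multiFactorial_add_single, Pi.add_apply, Pi.single_eq_same]
    have h2 : ((α i : ℝ) + 1) ≠ 0 := by positivity
    have h3 := (multiFactorial_pos α).ne'
    push_cast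
    field_simp

theorem hasDerivAt_comp_line {ψ : EuclideanSpace ℝ (Fin n) → ℝ} (hψ : ContDiff ℝ ∞ ψ)
    (y h : EuclideanSpace ℝ (Fin n)) (t : ℝ) :
    HasDerivAt (fun s : ℝ => ψ (y + s • h)) (∑ i, h i * partialDeriv i ψ (y + t • h)) t := by
  have h1 : HasDerivAt (fun s : ℝ => y + s • h) h t := by
    simpa using ((hasDerivAt_id t).smul_const h).const_add y
  have h2 : HasFDerivAt ψ (fderiv ℝ ψ (y + t • h)) (y + t • h) :=
    (hψ.differentiable (by simp)).differentiableAt.hasFDerivAt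
  have h3 : fderiv ℝ ψ (y + t • h) h = ∑ i, h i * partialDeriv i ψ (y + t • h) := by
    have h4 := congrArg (fderiv ℝ ψ (y + t • h)) ((EuclideanSpace.basisFun (Fin n) ℝ).sum_repr h)
    rw [← h4, map_sum]
    simp [HigherSobolev.partialDeriv]
  rw [← h3]
  exact h2.comp_hasDerivAt t h1

theorem hasDerivAt_taylorTerm {φ : EuclideanSpace ℝ (Fin n) → ℝ} (hφ : ContDiff ℝ ∞ φ) (j : ℕ)
    (y h : EuclideanSpace ℝ (Fin n)) (t : ℝ) :
    HasDerivAt (fun s : ℝ => taylorTerm (fun α => classicalDeriv α φ) j (y + s • h) h)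
      ((j + 1) * taylorTerm (fun α => classicalDeriv α φ) (j + 1) (y + t • h) h) t := by
  unfold taylorTerm
  rw [← sum_multiIndices_succ j (fun α => classicalDeriv α φ (y + t • h)) h]
  refine HasDerivAt.fun_sum fun α _ => HasDerivAt.mul_const ?_ _
  have := hasDerivAt_comp_line (contDiff_classicalDeriv hφ α) y h t
  simpa only [classicalDeriv_add_single hφ] using this

theorem taylorTerm_zero (D : (Fin n → ℕ) → EuclideanSpace ℝ (Fin n) → ℝ)
    (y h : EuclideanSpace ℝ (Fin n)) : taylorTerm D 0 y h = D 0 y := by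
  have : multiIndices n 0 = {0} := by
    ext α
    simp only [mem_multiIndices, order, Finset.sum_eq_zero_iff, Finset.mem_univ, true_imp_iff,
      Finset.mem_singleton]
    exact ⟨fun h => funext h, fun h i => by simp [h]⟩
  simp [taylorTerm, this, monomial, multiFactorial]

theorem continuous_taylorTerm_classicalDeriv {φ : EuclideanSpace ℝ (Fin n) → ℝ}
    (hφ : ContDiff ℝ ∞ φ) (j : ℕ) (h : EuclideanSpace ℝ (Fin n)) :
    Continuous fun y => taylorTerm (fun α => classicalDeriv α φ) j y h :=
  continuous_finsetSum _ fun α _ => (contDiff_classicalDeriv hφ α).continuous.mul_const _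

theorem hasDerivAt_neg_one_sub_pow (m : ℕ) (t : ℝ) :
    HasDerivAt (fun s : ℝ => -(1 - s) ^ (m + 1)) ((m + 1) * (1 - t) ^ m) t := by
  have h2 := (((hasDerivAt_id t).const_sub 1).pow (m + 1)).neg
  have h3 : -((m + 1 : ℕ) * (1 - id t) ^ (m + 1 - 1) * -1) = ((m : ℝ) + 1) * (1 - t) ^ m := by
    simp
  rw [h3] at h2
  exact h2

/-- Taylor's formula with integral remainder of order `m + 1`. -/
theorem taylor_formula {φ : EuclideanSpace ℝ (Fin n) → ℝ} (hφ : ContDiff ℝ ∞ φ) (m : ℕ)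
    (y h : EuclideanSpace ℝ (Fin n)) :
    φ (y + h) = ∑ j ∈ Finset.range (m + 1), taylorTerm (fun α => classicalDeriv α φ) j y h
      + ∫ t in (0 : ℝ)..1, (m + 1) * (1 - t) ^ m *
          taylorTerm (fun α => classicalDeriv α φ) (m + 1) (y + t • h) h := by
  have hc : ∀ j, Continuous fun t : ℝ =>
      taylorTerm (fun α => classicalDeriv α φ) j (y + t • h) h := fun j =>
    (continuous_taylorTerm_classicalDeriv hφ j h).comp (by fun_prop)
  induction m with
  | zero =>
    have h1 := intervalIntegral.integral_eq_sub_of_hasDerivAt (a := 0) (b := 1)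
      (fun t _ => hasDerivAt_taylorTerm hφ 0 y h t)
      ((continuous_const.mul (hc 1)).intervalIntegrable _ _)
    simp only [taylorTerm_zero, classicalDeriv_zero, one_smul, zero_smul, add_zero] at h1
    simp only [zero_add, Finset.range_one, Finset.sum_singleton, taylorTerm_zero,
      classicalDeriv_zero, pow_zero, mul_one]
    simp only [Nat.cast_zero, zero_add] at h1 ⊢
    rw [h1]; ring
  | succ m ih =>
    rw [ih, Finset.sum_range_succ _ (m + 1), add_assoc]
    congr 1
    have h1 := intervalIntegral.integral_deriv_mul_eq_sub (a := (0 : ℝ)) (b := 1)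
      (u := fun t => -(1 - t) ^ (m + 1)) (u' := fun t => (m + 1) * (1 - t) ^ m)
      (fun t _ => hasDerivAt_neg_one_sub_pow m t)
      (fun t _ => hasDerivAt_taylorTerm hφ (m + 1) y h t)
      (by apply Continuous.intervalIntegrable; fun_prop)
      ((continuous_const.mul (hc _)).intervalIntegrable _ _)
    rw [intervalIntegral.integral_add] at h1
    · simp at h1
      rw [eq_comm, ← sub_eq_iff_eq_add] at h1
      simp only [Nat.cast_add, Nat.cast_one]
      rw [← h1, sub_eq_add_neg, ← intervalIntegral.integral_neg, ← intervalIntegral.integral_neg]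
      congr 1
      refine intervalIntegral.integral_congr fun t _ => ?_
      ring
    · apply Continuous.intervalIntegrable
      exact Continuous.mul (by fun_prop) (hc _)
    · apply Continuous.intervalIntegrable
      exact Continuous.mul (by fun_prop) (continuous_const.mul (hc _))

/-! ### Averages along segments -/

/-- The probability measure `(m + 1) (1 - t)^m dt` on `[0, 1]`, the weight of the integral form of
the Taylor remainder of order `m`. -/
noncomputable def taylorMeasure (m : ℕ) : Measure ℝ :=
  (volume.restrict (Ioc (0 : ℝ) 1)).withDensity
    fun t => ENNReal.ofReal ((m + 1) * (1 - t) ^ m)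

theorem ae_taylorMeasure_mem_Icc (m : ℕ) : ∀ᵐ t ∂taylorMeasure m, t ∈ Icc (0 : ℝ) 1 := by
  refine (withDensity_absolutelyContinuous _ _).ae_le ?_
  filter_upwards [ae_restrict_mem measurableSet_Ioc] with t ht using ⟨ht.1.le, ht.2⟩

theorem integral_taylorMeasure (m : ℕ) (g : ℝ → ℝ) :
    ∫ t, g t ∂taylorMeasure m = ∫ t in (0 : ℝ)..1, (m + 1) * (1 - t) ^ m * g t := by
  rw [taylorMeasure, integral_withDensity_eq_integral_toReal_smul (by fun_prop) (by simp),
    intervalIntegral.integral_of_le zero_le_one]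
  refine setIntegral_congr_fun measurableSet_Ioc fun t ht => ?_
  have : 0 ≤ 1 - t := by linarith [ht.2]
  simp only [smul_eq_mul]
  rw [ENNReal.toReal_ofReal (by positivity)]

instance isProbabilityMeasure_taylorMeasure (m : ℕ) : IsProbabilityMeasure (taylorMeasure m) := by
  constructor
  rw [taylorMeasure, withDensity_apply _ MeasurableSet.univ, Measure.restrict_univ,
    ← ofReal_integral_eq_lintegral_ofReal]
  · rw [← intervalIntegral.integral_of_le zero_le_one]
    have h1 := intervalIntegral.integral_eq_sub_of_hasDerivAt (a := (0 : ℝ)) (b := 1)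
      (f := fun t => -(1 - t) ^ (m + 1)) (f' := fun t => ((m : ℝ) + 1) * (1 - t) ^ m)
      (fun t _ => hasDerivAt_neg_one_sub_pow m t)
      (by apply Continuous.intervalIntegrable; fun_prop)
    rw [h1]
    simp
  · exact (Continuous.integrableOn_Icc (by fun_prop)).mono_set Ioc_subset_Icc_self
  · filter_upwards [ae_restrict_mem measurableSet_Ioc] with t ht
    have : 0 ≤ 1 - t := by linarith [ht.2]
    simp only [Pi.zero_apply]
    positivity

section Segment

variable {G φ : EuclideanSpace ℝ (Fin n) → ℝ} {κ : Measure ℝ} [IsFiniteMeasure κ]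

theorem measurePreserving_shear (κ : Measure ℝ) [IsFiniteMeasure κ]
    (h : EuclideanSpace ℝ (Fin n)) :
    MeasurePreserving (fun z : EuclideanSpace ℝ (Fin n) × ℝ => (z.1 + z.2 • h, z.2))
      (volume.prod κ) (volume.prod κ) := by
  have h1 := (MeasurePreserving.id κ).skew_product (μb := κ)
    (μc := (volume : Measure (EuclideanSpace ℝ (Fin n)))) (μd := volume)
    (g := fun t y => y + t • h)
    (by fun_prop) (Eventually.of_forall fun t => (measurePreserving_add_right volume (t • h)).map_eq)
  have h2 := Measure.measurePreserving_swap (μ := (volume : Measure (EuclideanSpace ℝ (Fin n))))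
    (ν := κ)
  have h3 := Measure.measurePreserving_swap (μ := κ)
    (ν := (volume : Measure (EuclideanSpace ℝ (Fin n))))
  exact (h3.comp h1).comp h2

theorem integrable_mul_translate (hG : LocallyIntegrable G) (hφ : Continuous φ)
    (hc : HasCompactSupport φ) (hκ : ∀ᵐ t ∂κ, t ∈ Icc (0 : ℝ) 1) (h : EuclideanSpace ℝ (Fin n)) :
    Integrable (fun z : EuclideanSpace ℝ (Fin n) × ℝ => φ (z.1 - z.2 • h) * G z.1)
      (volume.prod κ) := by
  -- a compact set containing the supports of all the translates `φ (· - t • h)`, `t ∈ [0, 1]`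
  set B : Set (EuclideanSpace ℝ (Fin n)) :=
    (fun z : EuclideanSpace ℝ (Fin n) × ℝ => z.1 + z.2 • h) '' (tsupport φ ×ˢ Icc 0 1) with hB
  have hBc : IsCompact B := (hc.isCompact.prod isCompact_Icc).image (by fun_prop)
  have h1 : Integrable (B.indicator G) :=
    (hG.integrableOn_isCompact hBc).integrable_indicator hBc.measurableSet
  obtain ⟨C, hC⟩ := hc.exists_bound_of_continuous hφ
  have h2 : Integrable (fun z : EuclideanSpace ℝ (Fin n) × ℝ =>
      φ (z.1 - z.2 • h) * B.indicator G z.1) (volume.prod κ) :=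
    (h1.comp_fst κ).bdd_mul (c := C)
      (by apply Continuous.aestronglyMeasurable; fun_prop) (Eventually.of_forall fun z => hC _)
  refine h2.congr ?_
  have h3 : ∀ᵐ z ∂((volume : Measure (EuclideanSpace ℝ (Fin n))).prod κ), z.2 ∈ Icc (0 : ℝ) 1 :=
    Measure.quasiMeasurePreserving_snd.ae hκ
  filter_upwards [h3] with z hz
  by_cases hz' : φ (z.1 - z.2 • h) = 0
  · simp [hz']
  · rw [indicator_of_mem]
    exact ⟨(z.1 - z.2 • h, z.2), ⟨subset_tsupport φ hz', hz⟩, by simp⟩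

theorem integrable_mul_comp_shear (hG : LocallyIntegrable G) (hφ : Continuous φ)
    (hc : HasCompactSupport φ) (hκ : ∀ᵐ t ∂κ, t ∈ Icc (0 : ℝ) 1) (h : EuclideanSpace ℝ (Fin n)) :
    Integrable (fun z : EuclideanSpace ℝ (Fin n) × ℝ => φ z.1 * G (z.1 + z.2 • h))
      (volume.prod κ) := by
  have := (measurePreserving_shear κ h).integrable_comp_of_integrable
    (integrable_mul_translate hG hφ hc hκ h)
  simpa [Function.comp_def] using this

theorem locallyIntegrable_segment_average (hG : LocallyIntegrable G)
    (hκ : ∀ᵐ t ∂κ, t ∈ Icc (0 : ℝ) 1) (h : EuclideanSpace ℝ (Fin n)) :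
    LocallyIntegrable fun y => ∫ t, G (y + t • h) ∂κ := by
  rw [locallyIntegrable_iff]
  intro K hK
  obtain ⟨φ, hφ1, -, hφc, -⟩ := exists_continuous_one_zero_of_isCompact hK isClosed_empty
    (disjoint_empty K)
  have h1 := (integrable_mul_comp_shear hG φ.continuous hφc hκ h).integral_prod_left
  simp only [integral_const_mul] at h1
  refine h1.integrableOn.congr_fun (fun y hy => ?_) hK.measurableSet
  simp [hφ1 hy]

/-- Averaging `G` along the segments `[y, y + h]` is adjoint to averaging along `[y - h, y]`. -/
theorem integral_mul_segment_average (hG : LocallyIntegrable G) (hφ : Continuous φ)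
    (hc : HasCompactSupport φ) (hκ : ∀ᵐ t ∂κ, t ∈ Icc (0 : ℝ) 1) (h : EuclideanSpace ℝ (Fin n)) :
    ∫ y, φ y * ∫ t, G (y + t • h) ∂κ = ∫ t, (∫ y, G y * φ (y - t • h)) ∂κ := by
  simp_rw [← integral_const_mul]
  rw [integral_integral_swap (integrable_mul_comp_shear hG hφ hc hκ h)]
  refine integral_congr_ae (Eventually.of_forall fun t => ?_)
  simp only
  rw [← integral_add_right_eq_self (fun y => G y * φ (y - t • h)) (t • h)]
  simp [mul_comm]

theorem integral_integral_translate (hG : LocallyIntegrable G) (hφ : Continuous φ)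
    (hc : HasCompactSupport φ) (hκ : ∀ᵐ t ∂κ, t ∈ Icc (0 : ℝ) 1) (h : EuclideanSpace ℝ (Fin n)) :
    ∫ t, (∫ y, G y * φ (y - t • h)) ∂κ = ∫ y, G y * ∫ t, φ (y - t • h) ∂κ := by
  simp_rw [← integral_const_mul]
  rw [integral_integral_swap]
  have := (integrable_mul_translate hG hφ hc hκ h).swap
  simpa [Function.comp_def, Function.uncurry_def, mul_comm] using this

end Segment

/-! ### Taylor's formula for Sobolev functions -/

theorem partialDeriv_comp_add_right (φ : EuclideanSpace ℝ (Fin n) → ℝ) (i : Fin n)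
    (a : EuclideanSpace ℝ (Fin n)) :
    partialDeriv i (fun x => φ (x + a)) = fun x => partialDeriv i φ (x + a) := by
  funext x
  simp only [partialDeriv]
  rw [fderiv_comp_add_right]

theorem classicalDeriv_comp_add_right (φ : EuclideanSpace ℝ (Fin n) → ℝ) (α : Fin n → ℕ)
    (a : EuclideanSpace ℝ (Fin n)) :
    classicalDeriv α (fun x => φ (x + a)) = fun x => classicalDeriv α φ (x + a) := by
  unfold classicalDeriv
  induction List.finRange n with
  | nil => rfl
  | cons i l ih =>
    rw [List.foldr_cons, List.foldr_cons, ih]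
    induction α i with
    | zero => rfl
    | succ k ihk => rw [Function.iterate_succ_apply', ihk, partialDeriv_comp_add_right,
        Function.iterate_succ_apply']

theorem IsTestFunction.comp_sub_right {φ : EuclideanSpace ℝ (Fin n) → ℝ}
    (h : IsTestFunction univ φ) (a : EuclideanSpace ℝ (Fin n)) :
    IsTestFunction univ (fun x => φ (x - a)) where
  smooth := h.smooth.comp (contDiff_id.sub contDiff_const)
  compact := h.compact.comp_homeomorph (Homeomorph.subRight a)
  support := subset_univ _

theorem monomial_neg (α : Fin n → ℕ) (h : EuclideanSpace ℝ (Fin n)) :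
    monomial α (-h) = (-1) ^ order α * monomial α h := by
  simp only [monomial, order, ← Finset.prod_pow_eq_pow_sum, ← Finset.prod_mul_distrib, ← mul_pow]
  simp

theorem locallyIntegrable_taylorTerm {D : (Fin n → ℕ) → EuclideanSpace ℝ (Fin n) → ℝ} {j : ℕ}
    (hD : ∀ α, order α = j → LocallyIntegrable (D α)) (h : EuclideanSpace ℝ (Fin n)) :
    LocallyIntegrable fun y => taylorTerm D j y h := by
  unfold taylorTerm
  refine locallyIntegrable_finsetSum _ fun α hα => ?_
  have := (hD α (mem_multiIndices.1 hα)).smul (monomial α h / multiFactorial α)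
  simpa [Pi.smul_def, mul_comm] using this

theorem IsTestFunction.integrable_mul {f φ : EuclideanSpace ℝ (Fin n) → ℝ}
    (h : IsTestFunction univ φ) (hf : LocallyIntegrable f) : Integrable fun x => f x * φ x := by
  rw [← integrableOn_univ]
  exact h.integrableOn_mul (hf.locallyIntegrableOn univ)

theorem hasCompactSupport_taylorTerm_classicalDeriv {φ : EuclideanSpace ℝ (Fin n) → ℝ}
    (hφ : IsTestFunction univ φ) (j : ℕ) (h : EuclideanSpace ℝ (Fin n)) :
    HasCompactSupport fun y => taylorTerm (fun α => classicalDeriv α φ) j y h := by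
  unfold taylorTerm
  induction multiIndices n j using Finset.induction_on with
  | empty => exact HasCompactSupport.zero
  | insert α s hα ih =>
    simp only [Finset.sum_insert hα]
    exact ((hφ.classicalDeriv α).compact.mul_right).add ih

/-- Taylor's formula with integral remainder for a function with weak derivatives on `ℝⁿ`, at almost
every base point. By duality it follows from Taylor's formula for test functions
with increment `-h`. -/
theorem ae_taylor_formula {F : EuclideanSpace ℝ (Fin n) → ℝ}
    {D : (Fin n → ℕ) → EuclideanSpace ℝ (Fin n) → ℝ} {m : ℕ}
    (hD : ∀ α, order α ≤ m + 1 → HasWeakDeriv univ α F (D α))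
    (h : EuclideanSpace ℝ (Fin n)) :
    ∀ᵐ y, F (y + h) - ∑ j ∈ Finset.range (m + 1), taylorTerm D j y h
      = ∫ t, taylorTerm D (m + 1) (y + t • h) h ∂taylorMeasure m := by
  have hF : LocallyIntegrable F :=
    locallyIntegrableOn_univ.1 (hD 0 (by simp [order])).locallyIntegrable_left
  have hDl : ∀ α, order α ≤ m + 1 → LocallyIntegrable (D α) := fun α hα => by
    exact locallyIntegrableOn_univ.1 (hD α hα).locallyIntegrable_right
  have hκ := ae_taylorMeasure_mem_Icc m
  have hFh : LocallyIntegrable fun y => F (y + h) := by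
    rw [← (measurePreserving_add_right volume h).map_eq] at hF
    exact (locallyIntegrable_map_homeomorph (Homeomorph.addRight h)).1 hF
  have hS : LocallyIntegrable fun y => ∑ j ∈ Finset.range (m + 1), taylorTerm D j y h := by
    refine locallyIntegrable_finsetSum _ fun j hj => locallyIntegrable_taylorTerm (fun α hα => ?_) h
    exact hDl α (by rw [hα]; exact (Finset.mem_range.1 hj).le)
  have hT : LocallyIntegrable fun y => taylorTerm D (m + 1) y h :=
    locallyIntegrable_taylorTerm (fun α hα => hDl α hα.le) h
  refine ae_eq_of_integral_contDiff_smul_eq (hFh.sub hS)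
    (locallyIntegrable_segment_average hT hκ h) fun g hg hgc => ?_
  have hgt : IsTestFunction univ g := ⟨hg, hgc, subset_univ _⟩
  simp only [smul_eq_mul]
  -- the weak derivatives are moved onto the test function
  have hweak : ∀ j ≤ m + 1, ∀ ψ, IsTestFunction univ ψ → ∫ y, taylorTerm D j y h * ψ y
      = ∫ y, F y * taylorTerm (fun α => classicalDeriv α ψ) j y (-h) := by
    intro j hj ψ hψ
    simp only [taylorTerm, Finset.sum_mul, Finset.mul_sum]
    rw [integral_finsetSum, integral_finsetSum]
    · refine Finset.sum_congr rfl fun α hα => ?_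
      rw [mem_multiIndices] at hα
      have h1 := (hD α (hα.le.trans hj)).integral_eq ψ hψ
      simp only [Measure.restrict_univ] at h1
      have h2 : ((-1 : ℝ) ^ order α) * (-1) ^ order α = 1 := by
        rw [← mul_pow]; simp
      calc ∫ y, D α y * (monomial α h / multiFactorial α) * ψ y
          = monomial α h / multiFactorial α * ∫ y, D α y * ψ y := by
            rw [← integral_const_mul]; congr 1; funext y; ring
        _ = monomial α h / multiFactorial α *
            ((-1 : ℝ) ^ order α * ∫ y, F y * classicalDeriv α ψ y) := by
            rw [h1, ← mul_assoc ((-1 : ℝ) ^ order α), h2, one_mul]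
        _ = ∫ y, F y * (classicalDeriv α ψ y * (monomial α (-h) / multiFactorial α)) := by
            rw [← mul_assoc, ← integral_const_mul, monomial_neg]; congr 1; funext y; ring
    · intro α _
      have := ((hψ.classicalDeriv α).integrable_mul hF).mul_const
        (monomial α (-h) / multiFactorial α)
      simpa only [mul_assoc] using this
    · intro α hα
      rw [mem_multiIndices] at hα
      have := (hψ.integrable_mul (hDl α (hα.le.trans hj))).mul_const
        (monomial α h / multiFactorial α)
      simpa only [mul_assoc, mul_comm (ψ _)] using this
  have hterm : ∀ j, Integrable fun y => F y * taylorTerm (fun α => classicalDeriv α g) j y (-h) := by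
    intro j
    simp only [taylorTerm, Finset.mul_sum]
    refine integrable_finsetSum _ fun α _ => ?_
    have := ((hgt.classicalDeriv α).integrable_mul hF).mul_const
      (monomial α (-h) / multiFactorial α)
    simpa only [mul_assoc] using this
  have hL : ∫ y, g y * (F (y + h) - ∑ j ∈ Finset.range (m + 1), taylorTerm D j y h)
      = ∫ y, F y * (g (y + -h) -
          ∑ j ∈ Finset.range (m + 1), taylorTerm (fun α => classicalDeriv α g) j y (-h)) := by
    have e1 : ∫ y, g y * F (y + h) = ∫ y, F y * g (y + -h) := by
      rw [← integral_add_right_eq_self (fun y => F y * g (y + -h)) h]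
      congr 1; funext y; simp [mul_comm]
    have i1 : Integrable fun y => F y * g (y + -h) := by
      simpa only [sub_eq_add_neg] using (hgt.comp_sub_right h).integrable_mul hF
    have i2 : Integrable fun y => g y * F (y + h) := by
      simpa only [mul_comm] using hgt.integrable_mul hFh
    have i3 : ∀ j ∈ Finset.range (m + 1), Integrable fun y => g y * taylorTerm D j y h := by
      intro j hj
      simpa only [mul_comm] using hgt.integrable_mul
        (locallyIntegrable_taylorTerm
          (fun α hα => hDl α (hα.le.trans (Finset.mem_range.1 hj).le)) h)
    simp only [mul_sub, Finset.mul_sum]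
    rw [integral_sub i2 (integrable_finsetSum _ i3), integral_sub i1
      (integrable_finsetSum _ fun j _ => hterm j), e1, integral_finsetSum _ i3,
      integral_finsetSum _ fun j _ => hterm j]
    congr 1
    refine Finset.sum_congr rfl fun j hj => ?_
    rw [← hweak j (Finset.mem_range.1 hj).le g hgt]
    simp only [mul_comm]
  rw [hL, integral_mul_segment_average hT hg.continuous hgc hκ h]
  have hR : ∀ t : ℝ, ∫ y, taylorTerm D (m + 1) y h * g (y - t • h)
      = ∫ y, F y * taylorTerm (fun α => classicalDeriv α g) (m + 1) (y - t • h) (-h) := by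
    intro t
    rw [hweak (m + 1) le_rfl _ (hgt.comp_sub_right (t • h))]
    simp only [sub_eq_add_neg, taylorTerm, classicalDeriv_comp_add_right]
  simp_rw [hR]
  rw [integral_integral_translate hF
    (φ := fun x => taylorTerm (fun α => classicalDeriv α g) (m + 1) x (-h))
    (continuous_taylorTerm_classicalDeriv hg _ _) ?_ hκ h]
  · refine integral_congr_ae (Eventually.of_forall fun y => ?_)
    simp only
    rw [taylor_formula hg m y (-h), add_sub_cancel_left, integral_taylorMeasure]
    simp only [smul_neg, sub_eq_add_neg]
  · exact hasCompactSupport_taylorTerm_classicalDeriv hgt _ _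

/-! ### The error of the leading Taylor term -/

theorem continuous_monomial (α : Fin n → ℕ) : Continuous (monomial α) := by
  unfold monomial
  fun_prop

theorem abs_monomial_le (α : Fin n → ℕ) (h : EuclideanSpace ℝ (Fin n)) :
    |monomial α h| ≤ ‖h‖ ^ order α := by
  rw [monomial, Finset.abs_prod, order, ← Finset.prod_pow_eq_pow_sum]
  refine Finset.prod_le_prod (fun _ _ => abs_nonneg _) fun i _ => ?_
  rw [abs_pow]
  have := PiLp.norm_apply_le h i
  rw [Real.norm_eq_abs] at this
  gcongr

theorem one_le_multiFactorial (α : Fin n → ℕ) : 1 ≤ multiFactorial α := by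
  unfold multiFactorial
  exact_mod_cast Nat.one_le_iff_ne_zero.2 (Finset.prod_ne_zero_iff.2 fun i _ =>
    (α i).factorial_ne_zero)

theorem measurable_taylorTerm {D : (Fin n → ℕ) → EuclideanSpace ℝ (Fin n) → ℝ}
    (hD : ∀ α, Measurable (D α)) (j : ℕ) :
    Measurable fun z : EuclideanSpace ℝ (Fin n) × EuclideanSpace ℝ (Fin n) =>
      taylorTerm D j z.1 z.2 := by
  unfold taylorTerm
  refine Finset.measurable_sum _ fun α _ => ?_
  exact ((hD α).comp measurable_fst).mul
    (((continuous_monomial α).measurable.comp measurable_snd).div_const _)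

theorem taylorTerm_smul (D : (Fin n → ℕ) → EuclideanSpace ℝ (Fin n) → ℝ) (j : ℕ)
    (y h : EuclideanSpace ℝ (Fin n)) (r : ℝ) :
    taylorTerm D j y (r • h) = r ^ j * taylorTerm D j y h := by
  simp only [taylorTerm, Finset.mul_sum]
  refine Finset.sum_congr rfl fun α hα => ?_
  rw [mem_multiIndices] at hα
  have : monomial α (r • h) = r ^ j * monomial α h := by
    simp only [monomial, ← hα, order, ← Finset.prod_pow_eq_pow_sum, ← Finset.prod_mul_distrib,
      ← mul_pow]
    simp
  rw [this]; ring

/-- The constant comparing a homogeneous Taylor term with its coefficients, see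
`enorm_sum_monomial_rpow_le`. -/
noncomputable def termConst (n m : ℕ) (p : ℝ) : ℝ≥0∞ := ((multiIndices n m).card : ℝ≥0∞) ^ (p - 1)

theorem termConst_ne_top (n m : ℕ) {p : ℝ} (hp : 1 < p) : termConst n m p ≠ ⊤ :=
  ENNReal.rpow_ne_top_of_nonneg (by linarith) (ENNReal.natCast_ne_top _)

/-- For `h = 0` and `m ≥ 1` the left-hand side vanishes, since the division by `‖h‖ ^ m` gives
`0`. -/
theorem enorm_sum_monomial_rpow_le {p : ℝ} (hp : 1 < p) (m : ℕ) (c : (Fin n → ℕ) → ℝ)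
    (h : EuclideanSpace ℝ (Fin n)) :
    ‖(∑ α ∈ multiIndices n m, c α * (monomial α h / multiFactorial α)) / ‖h‖ ^ m‖ₑ ^ p
      ≤ termConst n m p * ∑ α ∈ multiIndices n m, ‖c α‖ₑ ^ p := by
  have h1 : ‖(∑ α ∈ multiIndices n m, c α * (monomial α h / multiFactorial α)) / ‖h‖ ^ m‖ₑ
      ≤ ∑ α ∈ multiIndices n m, ‖c α‖ₑ := by
    rw [Finset.sum_div]
    refine (enorm_sum_le _ _).trans (Finset.sum_le_sum fun α hα => ?_)
    rw [mem_multiIndices] at hα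
    refine enorm_le_iff_norm_le.2 ?_
    rw [mul_div_assoc, norm_mul]
    refine mul_le_of_le_one_right (norm_nonneg _) ?_
    rw [Real.norm_eq_abs, abs_div, abs_div, abs_of_pos (multiFactorial_pos α),
      abs_of_nonneg (by positivity : 0 ≤ ‖h‖ ^ m)]
    refine div_le_one_of_le₀ ?_ (by positivity)
    refine (div_le_self (abs_nonneg _) (one_le_multiFactorial α)).trans ?_
    rw [← hα]
    exact abs_monomial_le α h
  calc _ ≤ (∑ α ∈ multiIndices n m, ‖c α‖ₑ) ^ p := by gcongr
    _ ≤ _ := ENNReal.rpow_sum_le_const_mul_sum_rpow _ _ hp.le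

theorem eLpNorm_ofReal_rpow {X : Type*} [MeasurableSpace X] (κ : Measure X) {p : ℝ} (hp : 0 < p)
    (g : X → ℝ) : eLpNorm g (ENNReal.ofReal p) κ ^ p = ∫⁻ x, ‖g x‖ₑ ^ p ∂κ := by
  rw [eLpNorm_eq_lintegral_rpow_enorm_toReal (by simpa using hp) (by simp),
    ENNReal.toReal_ofReal hp.le, ← ENNReal.rpow_mul, one_div, inv_mul_cancel₀ hp.ne',
    ENNReal.rpow_one]

/-- Jensen's inequality for `|· - c| ^ p`. It needs no integrability of `g`, because the right-hand
side is infinite if `g` is not integrable. -/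
theorem enorm_integral_sub_rpow_le {X : Type*} [MeasurableSpace X] {κ : Measure X}
    [IsProbabilityMeasure κ] {p : ℝ} (hp : 1 < p) {g : X → ℝ} (hg : AEStronglyMeasurable g κ)
    (c : ℝ) : ‖∫ t, g t ∂κ - c‖ₑ ^ p ≤ ∫⁻ t, ‖g t - c‖ₑ ^ p ∂κ := by
  have hp0 : 0 < p := by linarith
  have hm : AEStronglyMeasurable (fun t => g t - c) κ := hg.sub aestronglyMeasurable_const
  have hle : (∫⁻ t, ‖g t - c‖ₑ ∂κ) ^ p ≤ ∫⁻ t, ‖g t - c‖ₑ ^ p ∂κ := by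
    have h1 := eLpNorm_le_eLpNorm_of_exponent_le (μ := κ) (p := 1) (q := ENNReal.ofReal p)
      (by rw [← ENNReal.ofReal_one]; exact ENNReal.ofReal_le_ofReal hp.le) hm
    rw [eLpNorm_one_eq_lintegral_enorm] at h1
    rw [← eLpNorm_ofReal_rpow κ hp0]
    gcongr
  by_cases hi : Integrable g κ
  · refine le_trans ?_ hle
    have : ∫ t, g t ∂κ - c = ∫ t, (g t - c) ∂κ := by
      rw [integral_sub hi (integrable_const c)]; simp
    rw [this]
    gcongr
    exact enorm_integral_le_lintegral_enorm _
  · have h2 : ∫⁻ t, ‖g t - c‖ₑ ∂κ = ⊤ := by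
      by_contra h3
      apply hi
      have h4 : Integrable (fun t => g t - c) κ := ⟨hm, lt_top_iff_ne_top.2 h3⟩
      exact (h4.add (integrable_const c)).congr (Eventually.of_forall fun t => by simp)
    rw [h2, ENNReal.top_rpow_of_pos hp0] at hle
    exact le_top.trans hle

/-- The `p`-th power of the `L^p` modulus of continuity of the coefficients of order `m`, for the
translation by `h`. -/
noncomputable def translationError (D : (Fin n → ℕ) → EuclideanSpace ℝ (Fin n) → ℝ) (m : ℕ) (p : ℝ)
    (h : EuclideanSpace ℝ (Fin n)) : ℝ≥0∞ :=
  ∫⁻ y, ∑ α ∈ multiIndices n m, ‖D α (y + h) - D α y‖ₑ ^ p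

theorem translationError_eq {D : (Fin n → ℕ) → EuclideanSpace ℝ (Fin n) → ℝ}
    (hD : ∀ α, Measurable (D α)) (m : ℕ) {p : ℝ} (hp : 1 < p) (h : EuclideanSpace ℝ (Fin n)) :
    translationError D m p h = ∑ α ∈ multiIndices n m,
      eLpNorm (fun y => D α (y + h) - D α y) (ENNReal.ofReal p) volume ^ p := by
  have hp0 : 0 < p := by linarith
  unfold translationError
  rw [lintegral_finsetSum]
  · exact Finset.sum_congr rfl fun α _ => (eLpNorm_ofReal_rpow volume hp0 _).symm
  · intro α _
    have := hD α
    fun_prop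

theorem exists_translationError_le {D : (Fin n → ℕ) → EuclideanSpace ℝ (Fin n) → ℝ}
    (hD : ∀ α, Measurable (D α)) {m : ℕ} {p : ℝ} (hp : 1 < p)
    (hDp : ∀ α, order α = m → MemLp (D α) (ENNReal.ofReal p)) :
    ∃ C : ℝ≥0∞, C ≠ ⊤ ∧ ∀ h, translationError D m p h ≤ C := by
  have hp0 : 0 < p := by linarith
  refine ⟨∑ α ∈ multiIndices n m, (eLpNorm (D α) (ENNReal.ofReal p) volume
    + eLpNorm (D α) (ENNReal.ofReal p) volume) ^ p, ?_, fun h => ?_⟩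
  · refine ENNReal.sum_ne_top.2 fun α hα => ENNReal.rpow_ne_top_of_nonneg hp0.le ?_
    have := (hDp α (mem_multiIndices.1 hα)).eLpNorm_ne_top
    exact ENNReal.add_ne_top.2 ⟨this, this⟩
  · rw [translationError_eq hD m hp]
    refine Finset.sum_le_sum fun α _ => ?_
    gcongr
    have hm := (hD α).aestronglyMeasurable (μ := (volume : Measure (EuclideanSpace ℝ (Fin n))))
    have h1 := eLpNorm_comp_measurePreserving (p := ENNReal.ofReal p) hm
      (measurePreserving_add_right volume h)
    have h2 := hm.comp_measurePreserving (measurePreserving_add_right volume h)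
    have h3 := eLpNorm_sub_le h2 hm (p := ENNReal.ofReal p)
      (by rw [← ENNReal.ofReal_one]; exact ENNReal.ofReal_le_ofReal hp.le)
    rw [h1] at h3
    exact h3

/-- Continuity of translations in `L^p`. -/
theorem tendsto_eLpNorm_translate_sub {p : ℝ≥0∞} (hp1 : 1 ≤ p) (hp : p ≠ ⊤)
    {g : EuclideanSpace ℝ (Fin n) → ℝ} (hg : MemLp g p) :
    Tendsto (fun h => eLpNorm (fun y => g (y + h) - g y) p volume) (𝓝 0) (𝓝 0) := by
  have : Fact (1 ≤ p) := ⟨hp1⟩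
  have : Fact (p ≠ ⊤) := ⟨hp⟩
  have h1 : Continuous fun h : EuclideanSpace ℝ (Fin n) => (DomAddAct.mk h) +ᵥ hg.toLp g := by
    have : Continuous fun h : EuclideanSpace ℝ (Fin n) => DomAddAct.mk h :=
      DomAddAct.continuous_mk
    exact this.vadd continuous_const
  have h2 := (h1.edist continuous_const (f := _) (g := fun _ => hg.toLp g)).tendsto 0
  have h3 : ∀ h : EuclideanSpace ℝ (Fin n), edist ((DomAddAct.mk h) +ᵥ hg.toLp g) (hg.toLp g)
      = eLpNorm (fun y => g (y + h) - g y) p volume := by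
    intro h
    rw [DomAddAct.mk_vadd_toLp, Lp.edist_toLp_toLp]
    congr 1
    funext y
    simp [add_comm]
  simp only [h3] at h2
  simpa using h2

theorem tendsto_translationError {D : (Fin n → ℕ) → EuclideanSpace ℝ (Fin n) → ℝ}
    (hD : ∀ α, Measurable (D α)) {m : ℕ} {p : ℝ} (hp : 1 < p)
    (hDp : ∀ α, order α = m → MemLp (D α) (ENNReal.ofReal p)) :
    Tendsto (translationError D m p) (𝓝 0) (𝓝 0) := by
  have hp0 : 0 < p := by linarith
  have h1 : Tendsto (fun h => ∑ α ∈ multiIndices n m,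
      eLpNorm (fun y => D α (y + h) - D α y) (ENNReal.ofReal p) volume ^ p) (𝓝 0)
      (𝓝 (∑ α ∈ multiIndices n m, (0 : ℝ≥0∞) ^ p)) := by
    refine tendsto_finsetSum _ fun α hα => ?_
    exact ((ENNReal.continuous_rpow_const (y := p)).tendsto 0).comp (tendsto_eLpNorm_translate_sub
      (by rw [← ENNReal.ofReal_one]; exact ENNReal.ofReal_le_ofReal hp.le) (by simp)
      (hDp α (mem_multiIndices.1 hα)))
  simp only [ENNReal.zero_rpow_of_pos hp0, Finset.sum_const_zero] at h1
  refine h1.congr fun h => (translationError_eq hD m hp h).symm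

/-- The modulus of continuity averaged over the segment `[0, h]` bounds the difference between the
Taylor remainder and its leading term. -/
theorem lintegral_remainder_sub_leading_le {F : EuclideanSpace ℝ (Fin n) → ℝ}
    {D : (Fin n → ℕ) → EuclideanSpace ℝ (Fin n) → ℝ} {m : ℕ} {p : ℝ} (hp : 1 < p)
    (hD : ∀ α, Measurable (D α)) (hw : ∀ α, order α ≤ m + 1 → HasWeakDeriv univ α F (D α))
    (h : EuclideanSpace ℝ (Fin n)) :
    ∫⁻ y, ‖(F (y + h) - ∑ j ∈ Finset.range (m + 1), taylorTerm D j y h) / ‖h‖ ^ (m + 1)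
        - taylorTerm D (m + 1) y h / ‖h‖ ^ (m + 1)‖ₑ ^ p
      ≤ termConst n (m + 1) p *
        ∫⁻ t, translationError D (m + 1) p (t • h) ∂taylorMeasure m := by
  have hsm : Measurable fun z : EuclideanSpace ℝ (Fin n) × ℝ =>
      ∑ α ∈ multiIndices n (m + 1), ‖D α (z.1 + z.2 • h) - D α z.1‖ₑ ^ p := by
    refine Finset.measurable_sum _ fun α _ => ?_
    have := hD α
    fun_prop
  calc _ ≤ ∫⁻ y, termConst n (m + 1) p * ∫⁻ t, ∑ α ∈ multiIndices n (m + 1),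
        ‖D α (y + t • h) - D α y‖ₑ ^ p ∂taylorMeasure m := by
        refine lintegral_mono_ae ?_
        filter_upwards [ae_taylor_formula hw h] with y hy
        rw [hy, ← integral_div]
        refine (enorm_integral_sub_rpow_le hp ?_ _).trans ?_
        · refine Measurable.aestronglyMeasurable ?_
          have h1 : Measurable fun t : ℝ => (y + t • h, h) := by fun_prop
          exact ((measurable_taylorTerm hD (m + 1)).comp h1).div_const _
        · have h3 : Measurable fun t : ℝ =>
              ∑ α ∈ multiIndices n (m + 1), ‖D α (y + t • h) - D α y‖ₑ ^ p := by
            refine Finset.measurable_sum _ fun α _ => ?_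
            have := hD α
            fun_prop
          rw [← lintegral_const_mul _ h3]
          refine lintegral_mono fun t => ?_
          have h2 := enorm_sum_monomial_rpow_le hp (m + 1)
            (fun α => D α (y + t • h) - D α y) h
          simpa only [taylorTerm, ← sub_div, ← Finset.sum_sub_distrib, ← sub_mul] using h2
    _ = _ := by
        rw [lintegral_const_mul _ hsm.lintegral_prod_right']
        congr 1
        rw [lintegral_lintegral_swap hsm.aemeasurable]
        rfl

/-! ### Polar coordinates and radial measures -/

theorem lintegral_polar (hn : 1 ≤ n) {Φ : EuclideanSpace ℝ (Fin n) → ℝ≥0∞} (hΦ : Measurable Φ) :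
    ∫⁻ h, Φ h = ∫⁻ e : Metric.sphere (0 : EuclideanSpace ℝ (Fin n)) 1,
      (∫⁻ r in Ioi (0 : ℝ), ENNReal.ofReal (r ^ (n - 1)) * Φ (r • (e : EuclideanSpace ℝ (Fin n))))
      ∂(volume : Measure (EuclideanSpace ℝ (Fin n))).toSphere := by
  have : Nonempty (Fin n) := ⟨⟨0, hn⟩⟩
  have : Nontrivial (EuclideanSpace ℝ (Fin n)) := inferInstance
  have h1 := (volume : Measure (EuclideanSpace ℝ (Fin n))).measurePreserving_homeomorphUnitSphereProd
  have h2 := h1.symm (homeomorphUnitSphereProd (EuclideanSpace ℝ (Fin n))).toMeasurableEquiv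
  have h3 := h2.lintegral_comp (f := fun x : ({0}ᶜ : Set (EuclideanSpace ℝ (Fin n))) => Φ x)
    (hΦ.comp measurable_subtype_coe)
  rw [lintegral_subtype_comap (measurableSet_singleton _).compl Φ, restrict_compl_singleton] at h3
  have hm : Measurable fun z : Metric.sphere (0 : EuclideanSpace ℝ (Fin n)) 1 × Ioi (0 : ℝ) =>
      Φ ((z.2 : ℝ) • (z.1 : EuclideanSpace ℝ (Fin n))) := by
    refine hΦ.comp ?_
    fun_prop
  rw [← h3]
  have h4 : ∀ z : Metric.sphere (0 : EuclideanSpace ℝ (Fin n)) 1 × Ioi (0 : ℝ),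
      Φ (((homeomorphUnitSphereProd (EuclideanSpace ℝ (Fin n))).toMeasurableEquiv.symm z :
        ({0}ᶜ : Set (EuclideanSpace ℝ (Fin n)))) : EuclideanSpace ℝ (Fin n))
      = Φ ((z.2 : ℝ) • (z.1 : EuclideanSpace ℝ (Fin n))) := fun z => by
    congr 1
  simp_rw [h4]
  rw [lintegral_prod _ hm.aemeasurable, finrank_euclideanSpace_fin]
  refine lintegral_congr fun e => ?_
  have hm' : Measurable fun r : Ioi (0 : ℝ) => Φ ((r : ℝ) • (e : EuclideanSpace ℝ (Fin n))) :=
    hm.comp measurable_prodMk_left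
  rw [Measure.volumeIoiPow, lintegral_withDensity_eq_lintegral_mul _ (by fun_prop) hm']
  exact lintegral_subtype_comap measurableSet_Ioi
    (fun r : ℝ => ENNReal.ofReal (r ^ (n - 1)) * Φ (r • (e : EuclideanSpace ℝ (Fin n))))

/-- The measure `η(|h|) dh` on `ℝⁿ`. -/
noncomputable def radialMeasure (n : ℕ) (η : ℝ → ℝ≥0∞) : Measure (EuclideanSpace ℝ (Fin n)) :=
  volume.withDensity fun h => η ‖h‖

theorem lintegral_radialMeasure (hn : 1 ≤ n) {η : ℝ → ℝ≥0∞} (hη : Measurable η)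
    {Φ : EuclideanSpace ℝ (Fin n) → ℝ≥0∞} (hΦ : Measurable Φ) :
    ∫⁻ h, Φ h ∂radialMeasure n η = ∫⁻ e : Metric.sphere (0 : EuclideanSpace ℝ (Fin n)) 1,
      (∫⁻ r in Ioi (0 : ℝ), ENNReal.ofReal (r ^ (n - 1)) *
        (η r * Φ (r • (e : EuclideanSpace ℝ (Fin n)))))
      ∂(volume : Measure (EuclideanSpace ℝ (Fin n))).toSphere := by
  have hη' : Measurable fun h : EuclideanSpace ℝ (Fin n) => η ‖h‖ := hη.comp measurable_norm
  rw [radialMeasure, lintegral_withDensity_eq_lintegral_mul _ hη' hΦ, lintegral_polar hn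
    (hη'.mul hΦ)]
  refine lintegral_congr fun e => setLIntegral_congr_fun measurableSet_Ioi fun r hr => ?_
  have he : ‖r • (e : EuclideanSpace ℝ (Fin n))‖ = r := by
    rw [norm_smul, mem_sphere_zero_iff_norm.1 e.2, mul_one, Real.norm_eq_abs, abs_of_pos hr]
  simp only [Pi.mul_apply, he]

theorem lintegral_radialMeasure_of_homogeneous (hn : 1 ≤ n) {η : ℝ → ℝ≥0∞} (hη : Measurable η)
    (hη1 : ∫⁻ r in Ioi (0 : ℝ), ENNReal.ofReal (r ^ (n - 1)) * η r = 1)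
    {Φ : EuclideanSpace ℝ (Fin n) → ℝ≥0∞} (hΦ : Measurable Φ)
    (hhom : ∀ r : ℝ, 0 < r → ∀ e, Φ (r • e) = Φ e) :
    ∫⁻ h, Φ h ∂radialMeasure n η = ∫⁻ e : Metric.sphere (0 : EuclideanSpace ℝ (Fin n)) 1, Φ e
      ∂(volume : Measure (EuclideanSpace ℝ (Fin n))).toSphere := by
  rw [lintegral_radialMeasure hn hη hΦ]
  refine lintegral_congr fun e => ?_
  calc _ = ∫⁻ r in Ioi (0 : ℝ), ENNReal.ofReal (r ^ (n - 1)) * η r * Φ e := by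
        refine setLIntegral_congr_fun measurableSet_Ioi fun r hr => ?_
        simp only [hhom r hr, mul_assoc]
    _ = _ := by
        rw [lintegral_mul_const _ (by fun_prop), hη1, one_mul]

theorem radialMeasure_norm_gt (hn : 1 ≤ n) {η : ℝ → ℝ≥0∞} (hη : Measurable η) {δ : ℝ}
    (hδ : 0 < δ) :
    radialMeasure n η {h | δ < ‖h‖} =
      (∫⁻ r in Ioi δ, ENNReal.ofReal (r ^ (n - 1)) * η r) *
        (volume : Measure (EuclideanSpace ℝ (Fin n))).toSphere univ := by
  have hs : MeasurableSet {h : EuclideanSpace ℝ (Fin n) | δ < ‖h‖} :=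
    measurableSet_lt measurable_const measurable_norm
  rw [← lintegral_indicator_one hs, lintegral_radialMeasure hn hη (measurable_one.indicator hs),
    ← lintegral_const]
  refine lintegral_congr fun e => ?_
  have h1 : Ioi δ = Ioi (0 : ℝ) ∩ Ioi δ := by
    rw [Ioi_inter_Ioi, max_eq_right hδ.le]
  rw [h1, inter_comm, ← setLIntegral_indicator measurableSet_Ioi]
  refine setLIntegral_congr_fun measurableSet_Ioi fun r hr => ?_
  have he : ‖r • (e : EuclideanSpace ℝ (Fin n))‖ = r := by
    rw [norm_smul, mem_sphere_zero_iff_norm.1 e.2, mul_one, Real.norm_eq_abs, abs_of_pos hr]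
  by_cases hr' : δ < r
  · simp [indicator, he, hr']
  · simp [indicator, he, hr']

theorem ae_comp_norm_of_ae_restrict_Ioi (hn : 1 ≤ n) {P : ℝ → Prop}
    (hP : ∀ᵐ r ∂volume.restrict (Ioi (0 : ℝ)), P r) :
    ∀ᵐ h : EuclideanSpace ℝ (Fin n), P ‖h‖ := by
  obtain ⟨N, hN, hNm, hN0⟩ := exists_measurable_superset_of_null (ae_iff.1 hP)
  have hNm' : MeasurableSet {h : EuclideanSpace ℝ (Fin n) | ‖h‖ ∈ N} := measurable_norm hNm
  have h1 : volume {h : EuclideanSpace ℝ (Fin n) | ‖h‖ ∈ N} = 0 := by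
    rw [← lintegral_indicator_one hNm', lintegral_polar hn (measurable_one.indicator hNm')]
    rw [lintegral_eq_zero_of_ae_eq_zero]
    refine Eventually.of_forall fun e => ?_
    refine lintegral_eq_zero_of_ae_eq_zero ?_
    filter_upwards [ae_restrict_mem measurableSet_Ioi, (measure_eq_zero_iff_ae_notMem.1 hN0)]
      with r hr hr'
    have he : ‖r • (e : EuclideanSpace ℝ (Fin n))‖ = r := by
      rw [norm_smul, mem_sphere_zero_iff_norm.1 e.2, mul_one, Real.norm_eq_abs, abs_of_pos hr]
    simp [indicator, he, hr']
  filter_upwards [measure_eq_zero_iff_ae_notMem.1 h1] with h hh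
  by_contra hc
  exact hh (hN hc)

/-- The measures `ρ_ε(|h|) dh`, described without reference to the particular representative of
`ρ_ε`: they integrate functions homogeneous of degree `0` like the surface measure of the sphere,
and they concentrate at the origin. -/
theorem IsMollifierFamily.exists_measure (hn : 1 ≤ n) {ρ : ℝ → ℝ → ℝ}
    (hρ : IsMollifierFamily n ρ) :
    ∃ μ : ℝ → Measure (EuclideanSpace ℝ (Fin n)),
      (∀ ε, SFinite (μ ε)) ∧
      (∀ ε, 0 < ε → ∀ Φ : EuclideanSpace ℝ (Fin n) → ℝ≥0∞, Measurable Φ →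
        ∫⁻ h, ENNReal.ofReal (ρ ε ‖h‖) * Φ h = ∫⁻ h, Φ h ∂μ ε) ∧
      (∀ ε, 0 < ε → ∀ Φ : EuclideanSpace ℝ (Fin n) → ℝ≥0∞, Measurable Φ →
        (∀ r : ℝ, 0 < r → ∀ e, Φ (r • e) = Φ e) →
        ∫⁻ h, Φ h ∂μ ε = ∫⁻ e : Metric.sphere (0 : EuclideanSpace ℝ (Fin n)) 1, Φ e
          ∂(volume : Measure (EuclideanSpace ℝ (Fin n))).toSphere) ∧
      ∀ δ, 0 < δ → Tendsto (fun ε => μ ε {h | δ < ‖h‖}) (𝓝[>] 0) (𝓝 0) := by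
  have hex : ∀ ε, ∃ η : ℝ → ℝ≥0∞, Measurable η ∧
      (0 < ε → ∀ᵐ r ∂volume.restrict (Ioi (0 : ℝ)), ENNReal.ofReal (ρ ε r) = η r) := by
    intro ε
    by_cases hε : 0 < ε
    · have h1 := (hρ.locallyIntegrable ε hε).aestronglyMeasurable.aemeasurable.ennreal_ofReal
      exact ⟨h1.mk _, h1.measurable_mk, fun _ => h1.ae_eq_mk⟩
    · exact ⟨0, measurable_zero, fun h => absurd h hε⟩
  choose η hηm hη using hex
  have hJ : ∀ ε, 0 < ε → ∀ δ, 0 ≤ δ → ∫⁻ r in Ioi δ, ENNReal.ofReal (r ^ (n - 1)) * η ε r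
      = ENNReal.ofReal (∫ r in Ioi δ, ρ ε r * r ^ (n - 1)) := by
    intro ε hε δ hδ
    -- the Bochner integral of a non-integrable function is `0`, so normalization gives integrability
    have hint : IntegrableOn (fun r => ρ ε r * r ^ (n - 1)) (Ioi 0) := by
      by_contra hc
      have h1 := hρ.integral_eq_one ε hε
      rw [integral_undef hc] at h1
      exact zero_ne_one h1
    have hsub : Ioi δ ⊆ Ioi (0 : ℝ) := Ioi_subset_Ioi hδ
    rw [ofReal_integral_eq_lintegral_ofReal (hint.mono_set hsub)]
    · refine lintegral_congr_ae ?_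
      filter_upwards [ae_restrict_of_ae_restrict_of_subset hsub (hη ε hε),
        ae_restrict_mem measurableSet_Ioi] with r hr hr'
      have h0 : (0 : ℝ) < r := hsub hr'
      rw [← hr, ← ENNReal.ofReal_mul (by positivity), mul_comm]
    · filter_upwards [ae_restrict_mem measurableSet_Ioi] with r hr'
      have h0 : (0 : ℝ) < r := hsub hr'
      exact mul_nonneg (hρ.nonneg ε hε r h0) (by positivity)
  refine ⟨fun ε => radialMeasure n (η ε), fun ε => ?_, fun ε hε Φ hΦ => ?_,
    fun ε hε Φ hΦ hhom => ?_, fun δ hδ => ?_⟩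
  · unfold radialMeasure; infer_instance
  · simp only [radialMeasure]
    have hη' : Measurable fun h : EuclideanSpace ℝ (Fin n) => η ε ‖h‖ := (hηm ε).comp measurable_norm
    rw [lintegral_withDensity_eq_lintegral_mul _ hη' hΦ]
    refine lintegral_congr_ae ?_
    filter_upwards [ae_comp_norm_of_ae_restrict_Ioi hn (hη ε hε)] with h hh
    simp only [Pi.mul_apply, hh]
  · refine lintegral_radialMeasure_of_homogeneous hn (hηm ε) ?_ hΦ hhom
    rw [hJ ε hε 0 le_rfl, hρ.integral_eq_one ε hε, ENNReal.ofReal_one]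
  · have h1 := ENNReal.Tendsto.mul_const (ENNReal.tendsto_ofReal (hρ.tendsto_tail δ hδ))
      (b := (volume : Measure (EuclideanSpace ℝ (Fin n))).toSphere univ)
      (Or.inr (measure_ne_top _ _))
    rw [ENNReal.ofReal_zero, zero_mul] at h1
    refine h1.congr' ?_
    filter_upwards [self_mem_nhdsWithin] with ε hε
    rw [radialMeasure_norm_gt hn (hηm ε) hδ, hJ ε hε δ hδ.le]

/-! ### Passage to the limit -/

theorem tendsto_average_translationError {τ : EuclideanSpace ℝ (Fin n) → ℝ≥0∞}
    (hτ : Tendsto τ (𝓝 0) (𝓝 0)) (m : ℕ) :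
    Tendsto (fun h => ∫⁻ t, τ (t • h) ∂taylorMeasure m) (𝓝 0) (𝓝 0) := by
  rw [ENNReal.tendsto_nhds_zero] at hτ ⊢
  intro c hc
  obtain ⟨δ, hδ, hball⟩ := Metric.eventually_nhds_iff.1 (hτ c hc)
  refine Metric.eventually_nhds_iff.2 ⟨δ, hδ, fun h hh => ?_⟩
  calc ∫⁻ t, τ (t • h) ∂taylorMeasure m ≤ ∫⁻ _, c ∂taylorMeasure m := by
        refine lintegral_mono_ae ?_
        filter_upwards [ae_taylorMeasure_mem_Icc m] with t ht
        refine hball ?_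
        rw [dist_zero_right] at hh ⊢
        rw [norm_smul, Real.norm_eq_abs, abs_of_nonneg ht.1]
        exact (mul_le_of_le_one_left (norm_nonneg _) ht.2).trans_lt hh
    _ = c := by simp

/-- Measures of bounded mass which concentrate at the origin integrate to `0` in the limit a
bounded function that vanishes continuously at the origin. -/
theorem tendsto_lintegral_of_concentrating {ι : Type*} {l : Filter ι}
    {μ : ι → Measure (EuclideanSpace ℝ (Fin n))} {M : ℝ≥0∞} (hM : M ≠ ⊤)
    (hmass : ∀ᶠ ε in l, μ ε univ ≤ M)
    (htail : ∀ δ, 0 < δ → Tendsto (fun ε => μ ε {h | δ < ‖h‖}) l (𝓝 0))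
    {σ : EuclideanSpace ℝ (Fin n) → ℝ≥0∞} {C : ℝ≥0∞} (hC : C ≠ ⊤) (hσC : ∀ h, σ h ≤ C)
    (hσ : Tendsto σ (𝓝 0) (𝓝 0)) :
    Tendsto (fun ε => ∫⁻ h, σ h ∂μ ε) l (𝓝 0) := by
  rw [ENNReal.tendsto_nhds_zero] at hσ ⊢
  intro c hc
  have hc2 : 0 < c / 2 := ENNReal.half_pos hc.ne'
  have hc' : 0 < c / 2 / (M + 1) :=
    ENNReal.div_pos hc2.ne' (ENNReal.add_ne_top.2 ⟨hM, ENNReal.one_ne_top⟩)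
  obtain ⟨δ, hδ, hball⟩ := Metric.eventually_nhds_iff.1 (hσ _ hc')
  have ht := ENNReal.Tendsto.const_mul (htail (δ / 2) (by positivity)) (a := C) (Or.inr hC)
  rw [mul_zero, ENNReal.tendsto_nhds_zero] at ht
  have hs : MeasurableSet {h : EuclideanSpace ℝ (Fin n) | δ / 2 < ‖h‖} :=
    measurableSet_lt measurable_const measurable_norm
  filter_upwards [hmass, ht _ hc2] with ε h1 h2
  calc ∫⁻ h, σ h ∂μ ε
      ≤ ∫⁻ h, (c / 2 / (M + 1) + {h | δ / 2 < ‖h‖}.indicator (fun _ => C) h) ∂μ ε := by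
        refine lintegral_mono fun h => ?_
        by_cases hh : δ / 2 < ‖h‖
        · rw [indicator_of_mem (by exact hh)]
          exact (hσC h).trans le_add_self
        · refine (hball ?_).trans le_self_add
          rw [dist_zero_right]
          linarith
    _ = c / 2 / (M + 1) * μ ε univ + C * μ ε {h | δ / 2 < ‖h‖} := by
        rw [lintegral_add_left measurable_const, lintegral_const, lintegral_indicator_const hs]
    _ ≤ c / 2 / (M + 1) * (M + 1) + c / 2 := by
        gcongr
        exact h1.trans le_self_add
    _ ≤ c := by
        rw [ENNReal.div_mul_cancel (by simp) (ENNReal.add_ne_top.2 ⟨hM, ENNReal.one_ne_top⟩),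
          ENNReal.add_halves]

theorem tendsto_of_le_add_of_le_add {ι : Type*} {l : Filter ι} {a e : ι → ℝ≥0∞} {b : ℝ≥0∞}
    (hb : b ≠ ⊤) (he : Tendsto e l (𝓝 0)) (h1 : ∀ᶠ i in l, a i ≤ b + e i)
    (h2 : ∀ᶠ i in l, b ≤ a i + e i) : Tendsto a l (𝓝 b) := by
  have hl : Tendsto (fun i => b - e i) l (𝓝 b) := by
    have := ENNReal.Tendsto.sub (tendsto_const_nhds (x := b)) he (Or.inl hb)
    simpa using this
  have hu : Tendsto (fun i => b + e i) l (𝓝 b) := by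
    simpa using (tendsto_const_nhds (x := b)).add he
  refine tendsto_of_tendsto_of_tendsto_of_le_of_le' hl hu ?_ h1
  filter_upwards [h2] with i hi
  exact tsub_le_iff_right.2 hi

section Limit

variable {F : EuclideanSpace ℝ (Fin n) → ℝ} {D : (Fin n → ℕ) → EuclideanSpace ℝ (Fin n) → ℝ}
  {m : ℕ} {p : ℝ} {Ω : Set (EuclideanSpace ℝ (Fin n))}

theorem lintegral_sum_coeff_ne_top (hp : 1 < p)
    (hDp : ∀ α, order α = m → MemLp (D α) (ENNReal.ofReal p)) (hD : ∀ α, Measurable (D α))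
    (Ω : Set (EuclideanSpace ℝ (Fin n))) :
    ∫⁻ y in Ω, ∑ α ∈ multiIndices n m, ‖D α y‖ₑ ^ p ≠ ⊤ := by
  have hp0 : 0 < p := by linarith
  refine ne_top_of_le_ne_top ?_ (setLIntegral_le_lintegral _ _)
  rw [lintegral_finsetSum]
  · refine ENNReal.sum_ne_top.2 fun α hα => ?_
    rw [← eLpNorm_ofReal_rpow volume hp0]
    exact ENNReal.rpow_ne_top_of_nonneg hp0.le (hDp α (mem_multiIndices.1 hα)).eLpNorm_ne_top
  · intro α _
    have := hD α
    fun_prop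

/-- The energy of the leading Taylor term over the increments `h` with `y + h ∉ Ω` is negligible,
because for every `y ∈ Ω` these stay away from the origin. -/
theorem tendsto_leading_exterior (hp : 1 < p) (hΩ : IsOpen Ω)
    (hD : ∀ α, Measurable (D α)) (hDp : ∀ α, order α = m → MemLp (D α) (ENNReal.ofReal p))
    {μ : ℝ → Measure (EuclideanSpace ℝ (Fin n))} [∀ ε, SFinite (μ ε)] {M : ℝ≥0∞} (hM : M ≠ ⊤)
    (hmass : ∀ᶠ ε in 𝓝[>] 0, μ ε univ ≤ M)
    (htail : ∀ δ, 0 < δ → Tendsto (fun ε => μ ε {h | δ < ‖h‖}) (𝓝[>] 0) (𝓝 0)) :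
    Tendsto (fun ε => ∫⁻ y in Ω, ∫⁻ h, {h | y + h ∉ Ω}.indicator
      (fun h => ‖taylorTerm D m y h / ‖h‖ ^ m‖ₑ ^ p) h ∂μ ε) (𝓝[>] 0) (𝓝 0) := by
  have hms : ∀ y, MeasurableSet {h : EuclideanSpace ℝ (Fin n) | y + h ∉ Ω} := fun y =>
    (hΩ.measurableSet.compl).preimage (measurable_const_add y)
  have hle : ∀ ε y, ∫⁻ h, {h | y + h ∉ Ω}.indicator
      (fun h => ‖taylorTerm D m y h / ‖h‖ ^ m‖ₑ ^ p) h ∂μ ε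
      ≤ (termConst n m p * ∑ α ∈ multiIndices n m, ‖D α y‖ₑ ^ p) * μ ε {h | y + h ∉ Ω} := by
    intro ε y
    rw [← lintegral_indicator_const (hms y)]
    refine lintegral_mono fun h => ?_
    exact indicator_le_indicator (enorm_sum_monomial_rpow_le hp m (fun α => D α y) h)
  have hsm : Measurable fun y => ∑ α ∈ multiIndices n m, ‖D α y‖ₑ ^ p := by
    refine Finset.measurable_sum _ fun α _ => ?_
    have := hD α
    fun_prop
  have hmm : ∀ ε, Measurable fun y => μ ε {h | y + h ∉ Ω} := fun ε => by
    have h1 : MeasurableSet {z : EuclideanSpace ℝ (Fin n) × EuclideanSpace ℝ (Fin n) |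
        z.1 + z.2 ∉ Ω} := hΩ.measurableSet.compl.preimage (by fun_prop)
    exact measurable_measure_prodMk_left h1
  have hlim : Tendsto (fun ε => ∫⁻ y in Ω, (termConst n m p *
      ∑ α ∈ multiIndices n m, ‖D α y‖ₑ ^ p) * μ ε {h | y + h ∉ Ω}) (𝓝[>] 0)
      (𝓝 (∫⁻ _ in Ω, 0)) := by
    refine tendsto_lintegral_filter_of_dominated_convergence
      (fun y => (termConst n m p * ∑ α ∈ multiIndices n m, ‖D α y‖ₑ ^ p) * M)
      (Eventually.of_forall fun ε => (hsm.const_mul _).mul (hmm ε)) ?_ ?_ ?_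
    · filter_upwards [hmass] with ε hε
      refine Eventually.of_forall fun y => ?_
      gcongr
      exact (measure_mono (subset_univ _)).trans hε
    · rw [lintegral_mul_const _ (hsm.const_mul _), lintegral_const_mul _ hsm]
      exact ENNReal.mul_ne_top (ENNReal.mul_ne_top (termConst_ne_top n m hp)
        (lintegral_sum_coeff_ne_top hp hDp hD Ω)) hM
    · have hfin : ∀ᵐ y ∂volume.restrict Ω, ∑ α ∈ multiIndices n m, ‖D α y‖ₑ ^ p < ⊤ :=
        Eventually.of_forall fun y => ENNReal.sum_lt_top.2 fun α _ =>
          ENNReal.rpow_lt_top_of_nonneg (by linarith) enorm_ne_top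
      filter_upwards [hfin, ae_restrict_mem hΩ.measurableSet] with y hy hyΩ
      obtain ⟨δ, hδ, hball⟩ := Metric.isOpen_iff.1 hΩ y hyΩ
      have h1 : Tendsto (fun ε => μ ε {h | y + h ∉ Ω}) (𝓝[>] 0) (𝓝 0) := by
        refine tendsto_of_tendsto_of_tendsto_of_le_of_le tendsto_const_nhds
          (htail (δ / 2) (by positivity)) (fun _ => zero_le) fun ε => measure_mono fun h hh => ?_
        by_contra hc
        simp only [mem_ofPred_eq, not_lt] at hc
        exact hh (hball (by simp; linarith))
      have h2 := ENNReal.Tendsto.const_mul h1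
        (a := termConst n m p * ∑ α ∈ multiIndices n m, ‖D α y‖ₑ ^ p)
        (Or.inr (ENNReal.mul_ne_top (termConst_ne_top n m hp) hy.ne))
      rwa [mul_zero] at h2
  rw [lintegral_zero] at hlim
  exact tendsto_of_tendsto_of_tendsto_of_le_of_le tendsto_const_nhds hlim (fun _ => zero_le)
    fun ε => lintegral_mono fun y => hle ε y

theorem tendsto_remainder_sub_leading (hp : 1 < p)
    (hD : ∀ α, Measurable (D α)) (hDp : ∀ α, order α = m + 1 → MemLp (D α) (ENNReal.ofReal p))
    (hw : ∀ α, order α ≤ m + 1 → HasWeakDeriv univ α F (D α))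
    {μ : ℝ → Measure (EuclideanSpace ℝ (Fin n))} {M : ℝ≥0∞} (hM : M ≠ ⊤)
    (hmass : ∀ᶠ ε in 𝓝[>] 0, μ ε univ ≤ M)
    (htail : ∀ δ, 0 < δ → Tendsto (fun ε => μ ε {h | δ < ‖h‖}) (𝓝[>] 0) (𝓝 0)) :
    Tendsto (fun ε => ∫⁻ h, ∫⁻ y,
      ‖(F (y + h) - ∑ j ∈ Finset.range (m + 1), taylorTerm D j y h) / ‖h‖ ^ (m + 1)
        - taylorTerm D (m + 1) y h / ‖h‖ ^ (m + 1)‖ₑ ^ p ∂volume ∂μ ε) (𝓝[>] 0) (𝓝 0) := by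
  obtain ⟨C, hC, hle⟩ := exists_translationError_le hD hp hDp
  have h1 := tendsto_lintegral_of_concentrating hM hmass htail
    (σ := fun h => termConst n (m + 1) p *
        ∫⁻ t, translationError D (m + 1) p (t • h) ∂taylorMeasure m)
    (C := termConst n (m + 1) p * C) (ENNReal.mul_ne_top (termConst_ne_top _ _ hp) hC)
    (fun h => ?_) ?_
  · exact tendsto_of_tendsto_of_tendsto_of_le_of_le tendsto_const_nhds h1 (fun _ => zero_le)
      fun ε => lintegral_mono fun h => lintegral_remainder_sub_leading_le hp hD hw h
  · gcongr
    calc _ ≤ ∫⁻ _, C ∂taylorMeasure m := lintegral_mono fun t => hle _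
      _ = C := by simp
  · have h2 := ENNReal.Tendsto.const_mul
      (tendsto_average_translationError (tendsto_translationError hD hp hDp) m)
      (a := termConst n (m + 1) p) (Or.inr (termConst_ne_top _ _ hp))
    rwa [mul_zero] at h2

theorem lintegral_leading_ne_top (hp : 1 < p)
    (hD : ∀ α, Measurable (D α)) (hDp : ∀ α, order α = m → MemLp (D α) (ENNReal.ofReal p))
    (Ω : Set (EuclideanSpace ℝ (Fin n))) :
    ∫⁻ y in Ω, ∫⁻ e : Metric.sphere (0 : EuclideanSpace ℝ (Fin n)) 1, ‖taylorTerm D m y e‖ₑ ^ p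
      ∂(volume : Measure (EuclideanSpace ℝ (Fin n))).toSphere ≠ ⊤ := by
  have hsm : Measurable fun y => ∑ α ∈ multiIndices n m, ‖D α y‖ₑ ^ p := by
    refine Finset.measurable_sum _ fun α _ => ?_
    have := hD α
    fun_prop
  have hle : ∀ y, ∫⁻ e : Metric.sphere (0 : EuclideanSpace ℝ (Fin n)) 1, ‖taylorTerm D m y e‖ₑ ^ p
      ∂(volume : Measure (EuclideanSpace ℝ (Fin n))).toSphere
      ≤ (termConst n m p * ∑ α ∈ multiIndices n m, ‖D α y‖ₑ ^ p) *
        (volume : Measure (EuclideanSpace ℝ (Fin n))).toSphere univ := by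
    intro y
    rw [← lintegral_const]
    refine lintegral_mono fun e => ?_
    have := enorm_sum_monomial_rpow_le hp m (fun α => D α y) (e : EuclideanSpace ℝ (Fin n))
    rwa [mem_sphere_zero_iff_norm.1 e.2, one_pow, div_one] at this
  refine ne_top_of_le_ne_top ?_ (lintegral_mono hle)
  rw [lintegral_mul_const _ (hsm.const_mul _), lintegral_const_mul _ hsm]
  exact ENNReal.mul_ne_top (ENNReal.mul_ne_top (termConst_ne_top n m hp)
    (lintegral_sum_coeff_ne_top hp hDp hD Ω)) (measure_ne_top _ _)

/-- The limit of the remainder energy, for a function with weak derivatives on the whole space and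
measures with the mass and homogeneity properties of `ρ_ε(|h|) dh`. -/
theorem tendsto_energy (hp : 1 < p) (hΩ : IsOpen Ω) (hF : Measurable F)
    (hD : ∀ α, Measurable (D α)) (hDp : ∀ α, order α = m + 1 → MemLp (D α) (ENNReal.ofReal p))
    (hw : ∀ α, order α ≤ m + 1 → HasWeakDeriv univ α F (D α))
    {μ : ℝ → Measure (EuclideanSpace ℝ (Fin n))} [∀ ε, SFinite (μ ε)]
    (hhom : ∀ ε, 0 < ε → ∀ Φ : EuclideanSpace ℝ (Fin n) → ℝ≥0∞, Measurable Φ →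
        (∀ r : ℝ, 0 < r → ∀ e, Φ (r • e) = Φ e) →
        ∫⁻ h, Φ h ∂μ ε = ∫⁻ e : Metric.sphere (0 : EuclideanSpace ℝ (Fin n)) 1, Φ e
          ∂(volume : Measure (EuclideanSpace ℝ (Fin n))).toSphere)
    (htail : ∀ δ, 0 < δ → Tendsto (fun ε => μ ε {h | δ < ‖h‖}) (𝓝[>] 0) (𝓝 0)) :
    Tendsto (fun ε => ∫⁻ y in Ω, ∫⁻ h, {h | y + h ∈ Ω}.indicator (fun h =>
      ‖(F (y + h) - ∑ j ∈ Finset.range (m + 1), taylorTerm D j y h) / ‖h‖ ^ (m + 1)‖ₑ ^ p) h ∂μ ε)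
      (𝓝[>] 0) (𝓝 (∫⁻ y in Ω, ∫⁻ e : Metric.sphere (0 : EuclideanSpace ℝ (Fin n)) 1,
        ‖taylorTerm D (m + 1) y e‖ₑ ^ p
          ∂(volume : Measure (EuclideanSpace ℝ (Fin n))).toSphere)) := by
  have hp0 : 0 < p := by linarith
  have hp1 : 1 ≤ ENNReal.ofReal p := by
    rw [← ENNReal.ofReal_one]; exact ENNReal.ofReal_le_ofReal hp.le
  set M := (volume : Measure (EuclideanSpace ℝ (Fin n))).toSphere univ
  have hM : M ≠ ⊤ := measure_ne_top _ _
  have hmass : ∀ᶠ ε in 𝓝[>] 0, μ ε univ ≤ M := by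
    filter_upwards [self_mem_nhdsWithin] with ε hε
    have h1 := hhom ε hε 1 measurable_one (fun _ _ _ => rfl)
    simp only [Pi.one_apply, lintegral_one] at h1
    exact h1.le
  -- the normalized remainder `r`, its leading part `q`, and the set of admissible pairs
  set r : EuclideanSpace ℝ (Fin n) × EuclideanSpace ℝ (Fin n) → ℝ := fun z =>
    (F (z.1 + z.2) - ∑ j ∈ Finset.range (m + 1), taylorTerm D j z.1 z.2) / ‖z.2‖ ^ (m + 1) with hr
  set q : EuclideanSpace ℝ (Fin n) × EuclideanSpace ℝ (Fin n) → ℝ := fun z =>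
    taylorTerm D (m + 1) z.1 z.2 / ‖z.2‖ ^ (m + 1) with hq
  set A : Set (EuclideanSpace ℝ (Fin n) × EuclideanSpace ℝ (Fin n)) := {z | z.1 + z.2 ∈ Ω} with hA
  have hAm : MeasurableSet A := hΩ.measurableSet.preimage (by fun_prop)
  have hrm : Measurable r := by
    refine Measurable.div (Measurable.sub (by fun_prop) ?_) (by fun_prop)
    exact Finset.measurable_sum _ fun j _ => measurable_taylorTerm hD j
  have hqm : Measurable q := (measurable_taylorTerm hD (m + 1)).div (by fun_prop)
  have hind : ∀ (B : Set (EuclideanSpace ℝ (Fin n) × EuclideanSpace ℝ (Fin n)))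
      (g : EuclideanSpace ℝ (Fin n) × EuclideanSpace ℝ (Fin n) → ℝ),
      (fun z => ‖B.indicator g z‖ₑ ^ p) = B.indicator fun z => ‖g z‖ₑ ^ p := by
    intro B g
    funext z
    by_cases hz : z ∈ B
    · simp [hz]
    · simp [hz, hp0]
  set ν : ℝ → Measure (EuclideanSpace ℝ (Fin n) × EuclideanSpace ℝ (Fin n)) :=
    fun ε => (volume.restrict Ω).prod (μ ε) with hν
  have hnorm : ∀ ε (B : Set (EuclideanSpace ℝ (Fin n) × EuclideanSpace ℝ (Fin n)))
      (g : EuclideanSpace ℝ (Fin n) × EuclideanSpace ℝ (Fin n) → ℝ), MeasurableSet B →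
      Measurable g → eLpNorm (B.indicator g) (ENNReal.ofReal p) (ν ε) ^ p
        = ∫⁻ y in Ω, ∫⁻ h, B.indicator (fun z => ‖g z‖ₑ ^ p) (y, h) ∂μ ε := by
    intro ε B g hB hg
    rw [eLpNorm_ofReal_rpow _ hp0, hind, lintegral_prod]
    exact ((hg.enorm.pow_const p).indicator hB).aemeasurable
  set S := ∫⁻ y in Ω, ∫⁻ e : Metric.sphere (0 : EuclideanSpace ℝ (Fin n)) 1,
        ‖taylorTerm D (m + 1) y e‖ₑ ^ p
          ∂(volume : Measure (EuclideanSpace ℝ (Fin n))).toSphere with hS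
  have hStop : S ≠ ⊤ := lintegral_leading_ne_top hp hD hDp Ω
  -- the leading part has the same norm for every `ε`
  have hb : ∀ ε, 0 < ε → eLpNorm q (ENNReal.ofReal p) (ν ε) = S ^ (1 / p) := by
    intro ε hε
    have h1 : eLpNorm q (ENNReal.ofReal p) (ν ε) ^ p = S := by
      rw [eLpNorm_ofReal_rpow _ hp0, lintegral_prod _ (hqm.enorm.pow_const p).aemeasurable, hS]
      refine lintegral_congr fun y => ?_
      have hqy : Measurable fun h => ‖q (y, h)‖ₑ ^ p :=
        (hqm.enorm.pow_const p).comp measurable_prodMk_left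
      rw [hhom ε hε _ hqy]
      · refine lintegral_congr fun e => ?_
        simp [hq]
      · intro s hs e
        simp only [hq]
        rw [taylorTerm_smul, norm_smul, mul_pow, Real.norm_eq_abs, abs_of_pos hs,
          mul_div_mul_left _ _ (by positivity)]
    rw [← h1, ← ENNReal.rpow_mul, mul_one_div_cancel hp0.ne', ENNReal.rpow_one]
  have hroot : ∀ {u : ℝ → ℝ≥0∞}, Tendsto (fun ε => u ε ^ p) (𝓝[>] 0) (𝓝 0) →
      Tendsto u (𝓝[>] 0) (𝓝 0) := by
    intro u hu
    have h1 := ((ENNReal.continuous_rpow_const (y := 1 / p)).tendsto 0).comp hu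
    rw [ENNReal.zero_rpow_of_pos (by positivity)] at h1
    refine h1.congr fun ε => ?_
    simp only [Function.comp_apply]
    rw [← ENNReal.rpow_mul, mul_one_div_cancel hp0.ne', ENNReal.rpow_one]
  have he1 : Tendsto (fun ε => eLpNorm (A.indicator (r - q)) (ENNReal.ofReal p) (ν ε))
      (𝓝[>] 0) (𝓝 0) := by
    refine hroot ?_
    refine tendsto_of_tendsto_of_tendsto_of_le_of_le tendsto_const_nhds
      (tendsto_remainder_sub_leading hp hD hDp hw hM hmass htail) (fun _ => zero_le) fun ε => ?_
    simp only
    rw [eLpNorm_ofReal_rpow _ hp0, hind]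
    calc _ ≤ ∫⁻ z, ‖(r - q) z‖ₑ ^ p ∂ν ε := lintegral_mono fun z => indicator_le_self _ _ z
      _ = ∫⁻ h, (∫⁻ y in Ω, ‖(r - q) (y, h)‖ₑ ^ p) ∂μ ε :=
        lintegral_prod_symm (μ := volume.restrict Ω) (ν := μ ε) _
          ((hrm.sub hqm).enorm.pow_const p).aemeasurable
      _ ≤ _ := lintegral_mono fun h => setLIntegral_le_lintegral _ _
  have he2 : Tendsto (fun ε => eLpNorm (Aᶜ.indicator q) (ENNReal.ofReal p) (ν ε))
      (𝓝[>] 0) (𝓝 0) := by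
    refine hroot ((tendsto_leading_exterior hp hΩ hD hDp hM hmass htail).congr fun ε => ?_)
    rw [hnorm ε _ _ hAm.compl hqm]
    rfl
  have hdec : A.indicator r - q = A.indicator (r - q) - Aᶜ.indicator q := by
    funext z
    by_cases hz : z ∈ A
    · simp [hz]
    · simp [hz]
  have hA1 : Measurable (A.indicator r) := hrm.indicator hAm
  have hd : ∀ ε, eLpNorm (A.indicator r - q) (ENNReal.ofReal p) (ν ε)
      ≤ eLpNorm (A.indicator (r - q)) (ENNReal.ofReal p) (ν ε)
        + eLpNorm (Aᶜ.indicator q) (ENNReal.ofReal p) (ν ε) := fun ε => by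
    rw [hdec]
    exact eLpNorm_sub_le ((hrm.sub hqm).indicator hAm).aestronglyMeasurable
      (hqm.indicator hAm.compl).aestronglyMeasurable hp1
  have he := he1.add he2
  rw [add_zero] at he
  have hlim : Tendsto (fun ε => eLpNorm (A.indicator r) (ENNReal.ofReal p) (ν ε)) (𝓝[>] 0)
      (𝓝 (S ^ (1 / p))) := by
    refine tendsto_of_le_add_of_le_add (ENNReal.rpow_ne_top_of_nonneg (by positivity) hStop) he ?_ ?_
    · filter_upwards [self_mem_nhdsWithin] with ε hε
      rw [← hb ε hε]
      have h1 := eLpNorm_add_le (μ := ν ε) hqm.aestronglyMeasurable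
        (hA1.sub hqm).aestronglyMeasurable hp1
      rw [add_sub_cancel] at h1
      exact h1.trans (by gcongr; exact hd ε)
    · filter_upwards [self_mem_nhdsWithin] with ε hε
      rw [← hb ε hε]
      have h1 := eLpNorm_sub_le (μ := ν ε) hA1.aestronglyMeasurable
        (hA1.sub hqm).aestronglyMeasurable hp1
      rw [sub_sub_cancel] at h1
      exact h1.trans (by gcongr; exact hd ε)
  have hfin := ((ENNReal.continuous_rpow_const (y := p)).tendsto _).comp hlim
  rw [← ENNReal.rpow_mul, one_div_mul_cancel hp0.ne', ENNReal.rpow_one] at hfin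
  refine hfin.congr fun ε => ?_
  simp only [Function.comp_apply]
  rw [hnorm ε _ _ hAm hrm]
  rfl

end Limit

/-! ### Weak derivatives: uniqueness, restriction, representatives -/

theorem HasWeakDeriv.mono {Ω Ω' : Set (EuclideanSpace ℝ (Fin n))} {α : Fin n → ℕ}
    {f g : EuclideanSpace ℝ (Fin n) → ℝ} (h : HasWeakDeriv Ω α f g) (hΩ : Ω' ⊆ Ω) :
    HasWeakDeriv Ω' α f g := by
  have key : ∀ {u φ : EuclideanSpace ℝ (Fin n) → ℝ}, IsTestFunction Ω' φ →
      ∫ x in Ω, u x * φ x = ∫ x in Ω', u x * φ x := by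
    intro u φ hφ
    have h0 : ∀ x, x ∉ Ω' → u x * φ x = 0 := fun x hx => by
      rw [image_eq_zero_of_notMem_tsupport fun h => hx (hφ.support h), mul_zero]
    rw [setIntegral_eq_integral_of_forall_compl_eq_zero fun x hx => h0 x fun h => hx (hΩ h),
      setIntegral_eq_integral_of_forall_compl_eq_zero h0]
  refine ⟨h.1.mono_set hΩ, h.2.mono_set hΩ, fun φ hφ => ?_⟩
  rw [← key (hφ.classicalDeriv α), ← key hφ]
  exact h.3 φ ⟨hφ.smooth, hφ.compact, hφ.support.trans hΩ⟩

theorem HasWeakDeriv.congr_right {Ω : Set (EuclideanSpace ℝ (Fin n))} {α : Fin n → ℕ}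
    {f g g' : EuclideanSpace ℝ (Fin n) → ℝ} (h : HasWeakDeriv Ω α f g)
    (hg : g =ᵐ[volume.restrict Ω] g') : HasWeakDeriv Ω α f g' :=
  ⟨h.1, h.2.congr hg, fun φ hφ => by
    rw [h.3 φ hφ]
    congr 1
    exact integral_congr_ae (hg.mono fun x hx => by simp only [hx])⟩

theorem HasWeakDeriv.ae_eq {Ω : Set (EuclideanSpace ℝ (Fin n))} (hΩ : IsOpen Ω) {α : Fin n → ℕ}
    {f g g' : EuclideanSpace ℝ (Fin n) → ℝ} (h : HasWeakDeriv Ω α f g)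
    (h' : HasWeakDeriv Ω α f g') : g =ᵐ[volume.restrict Ω] g' := by
  have h1 := hΩ.ae_eq_zero_of_integral_contDiff_smul_eq_zero (h.2.sub h'.2) fun φ hs hc hsup => by
    have hφ : IsTestFunction Ω φ := ⟨hs, hc, hsup⟩
    have h2 : ∫ x in Ω, g x * φ x = ∫ x in Ω, g' x * φ x := by
      have h3 := (h.3 φ hφ).symm.trans (h'.3 φ hφ)
      exact mul_left_cancel₀ (by simp) h3
    rw [← setIntegral_eq_integral_of_forall_compl_eq_zero (s := Ω)]
    · simp only [smul_eq_mul, Pi.sub_apply, mul_sub]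
      rw [integral_sub, sub_eq_zero]
      · simpa only [mul_comm] using h2
      · simpa only [IntegrableOn, mul_comm] using hφ.integrableOn_mul h.2
      · simpa only [IntegrableOn, mul_comm] using hφ.integrableOn_mul h'.2
    · intro x hx
      rw [image_eq_zero_of_notMem_tsupport fun h => hx (hsup h), zero_smul]
  filter_upwards [(ae_restrict_iff' hΩ.measurableSet).2 h1] with x hx
  exact sub_eq_zero.1 hx

theorem hasWeakDeriv_weakDeriv {Ω : Set (EuclideanSpace ℝ (Fin n))} {α : Fin n → ℕ}
    {f : EuclideanSpace ℝ (Fin n) → ℝ} (h : ∃ g, HasWeakDeriv Ω α f g) :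
    HasWeakDeriv Ω α f (weakDeriv Ω α f) := by
  unfold weakDeriv
  rw [dif_pos h]
  exact h.choose_spec

/-- A Sobolev function on an extension domain extends to `ℝⁿ`; the extension and its weak
derivatives have everywhere measurable representatives, which on `Ω` represent the given function
and its weak derivatives. -/
theorem IsExtensionDomain.exists_extension
    {Ω : TopologicalSpace.Opens (EuclideanSpace ℝ (Fin n))} {m : ℕ} {p : ℝ}
    (hΩ : IsExtensionDomain Ω m p) {f : EuclideanSpace ℝ (Fin n) → ℝ} (hf : MemSobolev Ω m p f) :
    ∃ (F : EuclideanSpace ℝ (Fin n) → ℝ) (D : (Fin n → ℕ) → EuclideanSpace ℝ (Fin n) → ℝ),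
      Measurable F ∧ (∀ α, Measurable (D α)) ∧
      (∀ α, order α ≤ m → MemLp (D α) (ENNReal.ofReal p)) ∧
      (∀ α, order α ≤ m → HasWeakDeriv univ α F (D α)) ∧
      F =ᵐ[volume.restrict (Ω : Set (EuclideanSpace ℝ (Fin n)))] f ∧
      ∀ α, order α ≤ m →
        D α =ᵐ[volume.restrict (Ω : Set (EuclideanSpace ℝ (Fin n)))] weakDeriv Ω α f := by
  obtain ⟨T, -, hT⟩ := hΩ
  set u : sobolevSpace Ω m p := ⟨hf.1.toLp f, hf.congr Ω.isOpen hf.1.coeFn_toLp.symm⟩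
  have hF := (T u).2
  set F : EuclideanSpace ℝ (Fin n) → ℝ := ((T u).1 : EuclideanSpace ℝ (Fin n) → ℝ)
  have hFS : MemSobolev (univ : Set (EuclideanSpace ℝ (Fin n))) m p F := hF
  have hFf : F =ᵐ[volume.restrict (Ω : Set (EuclideanSpace ℝ (Fin n)))] f :=
    (hT u).trans hf.1.coeFn_toLp
  have hex : ∀ α : Fin n → ℕ, ∃ g : EuclideanSpace ℝ (Fin n) → ℝ, Measurable g ∧
      (order α ≤ m → HasWeakDeriv univ α F g ∧ MemLp g (ENNReal.ofReal p)) := by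
    intro α
    by_cases hα : order α ≤ m
    · obtain ⟨g, hg, hgp⟩ := hFS.2 α hα
      rw [Measure.restrict_univ] at hgp
      have hae := hgp.1.ae_eq_mk
      refine ⟨hgp.1.mk g, hgp.1.stronglyMeasurable_mk.measurable, fun _ =>
        ⟨hg.congr_right ?_, hgp.ae_eq hae⟩⟩
      rwa [Measure.restrict_univ]
    · exact ⟨0, measurable_zero, fun h => absurd h hα⟩
  choose D hDm hD using hex
  refine ⟨F, D, (Lp.stronglyMeasurable (T u).1).measurable, hDm, fun α hα => (hD α hα).2,
    fun α hα => (hD α hα).1, hFf, fun α hα => ?_⟩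
  have h1 : HasWeakDeriv (Ω : Set (EuclideanSpace ℝ (Fin n))) α f (D α) :=
    ((hD α hα).1.mono (subset_univ _)).congr Ω.isOpen hFf
  exact h1.ae_eq Ω.isOpen (hasWeakDeriv_weakDeriv ⟨_, h1⟩)

theorem taylorRemainder_eq_taylorTerm (Ω : Set (EuclideanSpace ℝ (Fin n))) (k : ℕ)
    (f : EuclideanSpace ℝ (Fin n) → ℝ) (x y : EuclideanSpace ℝ (Fin n)) :
    taylorRemainder Ω k f x y = f x -
      ∑ j ∈ Finset.range (k + 1), taylorTerm (fun α => weakDeriv Ω α f) j y (x - y) := rfl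

theorem taylorTerm_congr {D D' : (Fin n → ℕ) → EuclideanSpace ℝ (Fin n) → ℝ} {j : ℕ}
    {y : EuclideanSpace ℝ (Fin n)} (hy : ∀ α, order α = j → D α y = D' α y)
    (h : EuclideanSpace ℝ (Fin n)) : taylorTerm D j y h = taylorTerm D' j y h :=
  Finset.sum_congr rfl fun α hα => by rw [hy α (mem_multiIndices.1 hα)]

theorem enorm_rpow_eq_ofReal {p : ℝ} (hp : 0 ≤ p) (a : ℝ) : ‖a‖ₑ ^ p = ENNReal.ofReal (|a| ^ p) := by
  rw [Real.enorm_eq_ofReal_abs, ENNReal.ofReal_rpow_of_nonneg (abs_nonneg a) hp]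

/-- For almost every `y ∈ Ω`, all weak derivatives of order at most `m` of `f` agree at `y` with
the representatives `D`. -/
theorem ae_forall_weakDeriv_eq {Ω : Set (EuclideanSpace ℝ (Fin n))} {m : ℕ}
    {f : EuclideanSpace ℝ (Fin n) → ℝ} {D : (Fin n → ℕ) → EuclideanSpace ℝ (Fin n) → ℝ}
    (hDf : ∀ α, order α ≤ m → D α =ᵐ[volume.restrict Ω] weakDeriv Ω α f) :
    ∀ᵐ y ∂volume.restrict Ω, ∀ α, order α ≤ m → D α y = weakDeriv Ω α f y := by
  rw [ae_all_iff]
  intro α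
  by_cases hα : order α ≤ m
  · filter_upwards [hDf α hα] with y hy _ using hy
  · exact Eventually.of_forall fun y h => absurd h hα

theorem sphericalEnergy_eq {Ω : Set (EuclideanSpace ℝ (Fin n))} {m : ℕ} {p : ℝ} (hp : 0 ≤ p)
    {f : EuclideanSpace ℝ (Fin n) → ℝ} {D : (Fin n → ℕ) → EuclideanSpace ℝ (Fin n) → ℝ}
    (hDf : ∀ α, order α ≤ m → D α =ᵐ[volume.restrict Ω] weakDeriv Ω α f) :
    sphericalEnergy Ω m p f = ∫⁻ y in Ω, ∫⁻ e : Metric.sphere (0 : EuclideanSpace ℝ (Fin n)) 1,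
      ‖taylorTerm D m y e‖ₑ ^ p ∂(volume : Measure (EuclideanSpace ℝ (Fin n))).toSphere := by
  unfold sphericalEnergy
  refine lintegral_congr_ae ?_
  filter_upwards [ae_forall_weakDeriv_eq hDf] with y hy
  refine lintegral_congr fun e => ?_
  rw [enorm_rpow_eq_ofReal hp, taylorTerm_congr (fun α hα => hy α hα.le)]
  simp only [taylorTerm, div_mul_eq_mul_div, mul_div_assoc]

/-- The remainder energy in the variables `y` and `h = x - y`, and in terms of the extension;
`μ` stands for `η(|h|) dh`. -/
theorem remainderEnergy_eq {Ω : Set (EuclideanSpace ℝ (Fin n))} (hΩ : IsOpen Ω) {m : ℕ} {p : ℝ}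
    (hp : 0 ≤ p) {f F : EuclideanSpace ℝ (Fin n) → ℝ}
    {D : (Fin n → ℕ) → EuclideanSpace ℝ (Fin n) → ℝ} (hF : Measurable F)
    (hD : ∀ α, Measurable (D α)) (hFf : F =ᵐ[volume.restrict Ω] f)
    (hDf : ∀ α, order α ≤ m + 1 → D α =ᵐ[volume.restrict Ω] weakDeriv Ω α f)
    {η : ℝ → ℝ} {μ : Measure (EuclideanSpace ℝ (Fin n))}
    (hμ : ∀ Φ : EuclideanSpace ℝ (Fin n) → ℝ≥0∞, Measurable Φ →
        ∫⁻ h, ENNReal.ofReal (η ‖h‖) * Φ h = ∫⁻ h, Φ h ∂μ) :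
    remainderEnergy Ω (m + 1) p η f = ∫⁻ y in Ω, ∫⁻ h, {h | y + h ∈ Ω}.indicator (fun h =>
      ‖(F (y + h) - ∑ j ∈ Finset.range (m + 1), taylorTerm D j y h) / ‖h‖ ^ (m + 1)‖ₑ ^ p) h ∂μ := by
  unfold remainderEnergy
  refine lintegral_congr_ae ?_
  filter_upwards [ae_forall_weakDeriv_eq hDf] with y hy
  have hm : Measurable fun h => {h | y + h ∈ Ω}.indicator (fun h =>
      ‖(F (y + h) - ∑ j ∈ Finset.range (m + 1), taylorTerm D j y h) / ‖h‖ ^ (m + 1)‖ₑ ^ p) h := by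
    refine Measurable.indicator ?_ (hΩ.measurableSet.preimage (measurable_const_add y))
    refine Measurable.pow_const (Measurable.enorm (Measurable.div (Measurable.sub (by fun_prop) ?_)
      (by fun_prop))) p
    exact Finset.measurable_sum _ fun j _ =>
      (measurable_taylorTerm hD j).comp measurable_prodMk_left
  rw [← hμ _ hm, ← lintegral_indicator hΩ.measurableSet, ← lintegral_add_left_eq_self _ y]
  have hFf' : ∀ᵐ x, x ∈ Ω → F x = f x := (ae_restrict_iff' hΩ.measurableSet).1 hFf
  have hshift : ∀ᵐ h, y + h ∈ Ω → F (y + h) = f (y + h) :=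
    (measurePreserving_add_left volume y).quasiMeasurePreserving.ae hFf'
  refine lintegral_congr_ae ?_
  filter_upwards [hshift] with h hh
  by_cases hyh : y + h ∈ Ω
  · have hterm : ∀ j ∈ Finset.range (m + 1), taylorTerm (fun α => weakDeriv Ω α f) j y h
        = taylorTerm D j y h := fun j hj =>
      taylorTerm_congr (fun α hα => (hy α (hα.le.trans (Finset.mem_range.1 hj).le)).symm) h
    rw [indicator_of_mem hyh, indicator_of_mem (by exact hyh), taylorRemainder_eq_taylorTerm,
      add_tsub_cancel_right, add_sub_cancel_left, Finset.sum_congr rfl hterm, ← hh hyh,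
      enorm_rpow_eq_ofReal hp, abs_div, Real.div_rpow (abs_nonneg _) (abs_nonneg _),
      abs_of_nonneg (by positivity : 0 ≤ ‖h‖ ^ (m + 1)), ← Real.rpow_natCast_mul (norm_nonneg h),
      ENNReal.ofReal_mul (by positivity), mul_comm]
  · rw [indicator_of_notMem hyh, indicator_of_notMem (by exact hyh), mul_zero]

end HigherSobolev

theorem mainTheorem2 (n m : ℕ) (hn : 1 ≤ n) (hm : 1 ≤ m) (p : ℝ) (hp : 1 < p)
    (Ω : TopologicalSpace.Opens (EuclideanSpace ℝ (Fin n))) (hΩ : IsExtensionDomain Ω m p)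
    (ρ : ℝ → ℝ → ℝ) (hρ : IsMollifierFamily n ρ)
    (f : EuclideanSpace ℝ (Fin n) → ℝ) (hf : MemSobolev Ω m p f) :
    sphericalEnergy Ω m p f < ⊤ ∧
      Tendsto (fun ε : ℝ => remainderEnergy Ω m p (ρ ε) f) (𝓝[>] 0)
        (𝓝 (sphericalEnergy Ω m p f)) := by
  obtain ⟨k, rfl⟩ : ∃ k, m = k + 1 := ⟨m - 1, by omega⟩
  have hp0 : 0 ≤ p := by linarith
  obtain ⟨F, D, hF, hD, hDp, hw, hFf, hDf⟩ := hΩ.exists_extension hf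
  obtain ⟨μ, hμs, hμ, hhom, htail⟩ := hρ.exists_measure hn
  rw [sphericalEnergy_eq hp0 hDf]
  refine ⟨lt_top_iff_ne_top.2
    (lintegral_leading_ne_top hp hD (fun α hα => hDp α hα.le) _), ?_⟩
  refine (tendsto_energy hp Ω.isOpen hF hD (fun α hα => hDp α hα.le) hw hhom htail).congr' ?_
  filter_upwards [self_mem_nhdsWithin] with ε hε
  exact (remainderEnergy_eq Ω.isOpen hp0 hF hD hFf hDf (hμ ε hε)).symm
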